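/- Let $(\mathcal T_n)_{n\ge 1}$ be the random recursive tree process: $\mathcal T_1$ consists of the root only, and $\mathcal T_{n+1}$ arises from $\mathcal T_n$ by attaching a new vertex as a child of a vertex of $\mathcal T_n$ that is chosen uniformly at random among its $n$ vertices, independently of all previous choices. Let $\Upsilon(\mathcal T_n)=\sum_v d_v$ be the total path length of $\mathcal T_n$, where $v$ runs over the vertices of $\mathcal T_n$ and $d_v$ is the number of edges on the path from $v$ to the root. Then there is a random variable $X$ with $$\frac{\Upsilon(\mathcal T_n)-\mathbb E[\Upsilon(\mathcal T_n)]}{n}\longrightarrow X\qquad\text{almost surely and in } L_p \text{ for every } 0<p<\infty,$$ and the limit $X$ (which is almost surely unique) admits a Schwartz density: there is a nonnegative Schwartz function $f$ on $\mathbb R$ (a smooth function such that $f$ and all its derivatives decay faster than any power of $1/|x|$ as $|x|\to\infty$) such that $\mathbb P(X\in B)=\int_B f(x)\,dx$ for every Borel set $B\subseteq\mathbb R$. -/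

import Mathlib

open MeasureTheory ProbabilityTheory Filter Topology
open scoped ENNReal

/-- The recursive tree with the `n + 1` vertices `0, …, n` and root `0` in which, for `i < n`,
the parent of the vertex `i + 1` is the vertex `k i ∈ {0, …, i}`. -/
def recursiveTree (k : ∀ i : ℕ, Fin (i + 1)) (n : ℕ) : SimpleGraph (Fin (n + 1)) :=
  SimpleGraph.fromRel fun u v => ∃ i : ℕ, (v : ℕ) = i + 1 ∧ (u : ℕ) = (k i : ℕ)

/-- The total path length (with respect to the vertices) of a finite tree `T` with root `r`:
the sum over all vertices of the graph distance to the root. -/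
noncomputable def totalPathLength {V : Type*} [Fintype V] (T : SimpleGraph V) (r : V) : ℕ :=
  ∑ v : V, T.dist r v

/-- The random choices that grow a random recursive tree: the vertices `1, 2, …` are attached one
after the other, and the parent `K i` of the vertex `i + 1` is uniformly distributed on
`{0, …, i}`, independently of all the other choices. -/
structure IsUniformAttachment {Ω : Type*} [MeasurableSpace Ω] (μ : Measure Ω)
    (K : ∀ i : ℕ, Ω → Fin (i + 1)) : Prop where
  measurable : ∀ i, Measurable (K i)
  uniform : ∀ (i : ℕ) (j : Fin (i + 1)), μ {ω | K i ω = j} = ((i : ℝ≥0∞) + 1)⁻¹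
  indep : iIndepFun K μ

/-- The total path length of the random recursive tree with `n + 1` vertices. -/
noncomputable def rrtPathLength {Ω : Type*} (K : ∀ i : ℕ, Ω → Fin (i + 1)) (n : ℕ) (ω : Ω) : ℝ :=
  (totalPathLength (recursiveTree (fun i => K i ω) n) 0 : ℝ)

/-- The total path length of the random recursive tree with `n + 1` vertices, centred at its
expectation and divided by the number of vertices. -/
noncomputable def normalizedPathLength {Ω : Type*} [MeasurableSpace Ω] (μ : Measure Ω)
    (K : ∀ i : ℕ, Ω → Fin (i + 1)) (n : ℕ) (ω : Ω) : ℝ :=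
  (rrtPathLength K n ω - ∫ ω', rrtPathLength K n ω' ∂μ) / ((n : ℝ) + 1)

/-- A measure on the line has a Schwartz density: it is absolutely continuous with respect to
Lebesgue measure, with a nonnegative Schwartz function as density. -/
def HasSchwartzDensity (ν : Measure ℝ) : Prop :=
  ∃ f : SchwartzMap ℝ ℝ, (∀ x, 0 ≤ f x) ∧
    ν = (volume : Measure ℝ).withDensity (fun x => ENNReal.ofReal (f x))

/-! Convergence. Attaching a vertex increases the path length by one plus the depth of its parent,
and the average depth is the path length divided by the number of vertices. Centring and normalizing
therefore give a martingale with increments `depthDeviation` over `n + 2`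
(`normalizedPathLength_succ`). The exact value of the expected sum of `2 ^ depth` bounds the moments
of the deviations. A second order expansion and a discrete Grönwall argument then bound every even
moment of the martingale (`exists_integral_normalizedPathLength_pow_le`). Almost sure convergence
and convergence in every `L^p` follow (`exists_limit`).

Distributional equation. Cutting the edge between the root and the vertex `1` leaves two recursive
trees, independent given their sizes, with uniform split. This is proved by counting attachments
(`attachmentSum_add`) and becomes a recursion for characteristic functions. In the limit, harmonic
numbers turn into logarithms, and the limit law satisfies `X = U X' + (1 - U) X'' + U - H(U)` in
distribution (`solvesSplittingEquation`).

Smoothness. For fixed `X'` and `X''` the phase in `U` is an affine function minus the entropy. Its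
second derivative is at least `4` whatever the slope, so van der Corput's method gives `|φ(t)| ≤ 5 /
√t` for the characteristic function `φ`. Feeding this back into `φ(t) = ∫ φ(ut) φ((1 - u)t) ⋯ du`
gains a factor `t ^ (-1/2)` each time, so `φ` decays faster than any power. Since all moments are
finite, the derivatives of `φ` are bounded, and Landau's inequality passes the decay on to them. So
`φ` is Schwartz, and Fourier inversion yields the density. -/

/-! ### Oscillatory integrals -/

/-- The first derivative test of van der Corput for a convex increasing phase. -/
theorem norm_integral_exp_le_of_convex {h h' h'' : ℝ → ℝ} {a b t : ℝ} (hab : a ≤ b) (ht : 0 < t)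
    (hd : ∀ x ∈ Set.Icc a b, HasDerivAt h (h' x) x)
    (hd' : ∀ x ∈ Set.Icc a b, HasDerivAt h' (h'' x) x)
    (hc : ContinuousOn h'' (Set.Icc a b)) (hpos : ∀ x ∈ Set.Icc a b, 0 < h' x)
    (hconv : ∀ x ∈ Set.Icc a b, 0 ≤ h'' x) :
    ‖∫ x in a..b, Complex.exp (Complex.I * ↑(t * h x))‖ ≤ 2 / (t * h' a) := by
  have hu : Set.uIcc a b = Set.Icc a b := Set.uIcc_of_le hab
  have hch : ContinuousOn h (Set.uIcc a b) := fun x hx =>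
    (hd x (hu ▸ hx)).continuousAt.continuousWithinAt
  have hch' : ContinuousOn h' (Set.uIcc a b) := fun x hx =>
    (hd' x (hu ▸ hx)).continuousAt.continuousWithinAt
  have hq : ContinuousOn (fun x => h'' x / h' x ^ 2) (Set.uIcc a b) :=
    (hu ▸ hc).div (hch'.pow 2) fun x hx => (pow_pos (hpos x (hu ▸ hx)) 2).ne'
  have he : ContinuousOn (fun x => Complex.exp (Complex.I * ↑(t * h x))) (Set.uIcc a b) := by
    fun_prop
  have heq : ContinuousOn (fun x => Complex.exp (Complex.I * ↑(t * h x)) * ↑(h'' x / h' x ^ 2))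
      (Set.uIcc a b) := he.mul (Complex.continuous_ofReal.comp_continuousOn hq)
  have hinv : ∀ x ∈ Set.uIcc a b, HasDerivAt (fun x => -(h' x)⁻¹) (h'' x / h' x ^ 2) x := by
    intro x hx
    exact ((hd' x (hu ▸ hx)).inv (hpos x (hu ▸ hx)).ne').neg.congr_deriv (by ring)
  -- Integration by parts: writing the integrand as the derivative of `exp (i t h)` over `i t h'`
  -- leaves boundary terms and an integral against the derivative of `-1 / h'`.
  have hF : ∀ x ∈ Set.uIcc a b, HasDerivAt
      (fun x => Complex.exp (Complex.I * ↑(t * h x)) * ↑(-(h' x)⁻¹))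
      (Complex.exp (Complex.I * ↑(t * h x)) * ↑(h'' x / h' x ^ 2)
        - Complex.I * t * Complex.exp (Complex.I * ↑(t * h x))) x := by
    intro x hx
    have h1 := ((((hd x (hu ▸ hx)).const_mul t).ofReal_comp).const_mul Complex.I).cexp
    refine (h1.mul (hinv x hx).ofReal_comp).congr_deriv ?_
    have : (h' x : ℂ) ≠ 0 := by exact_mod_cast (hpos x (hu ▸ hx)).ne'
    push_cast
    field_simp
    ring
  have hint := intervalIntegral.integral_eq_sub_of_hasDerivAt hF
    ((heq.sub (he.const_smul (Complex.I * (t : ℂ)))).intervalIntegrable.congr (by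
      intro x _; simp))
  rw [intervalIntegral.integral_sub heq.intervalIntegrable
    (he.intervalIntegrable.const_mul _), intervalIntegral.integral_const_mul] at hint
  have hreal := intervalIntegral.integral_eq_sub_of_hasDerivAt hinv hq.intervalIntegrable
  have hn : ∀ x, ‖Complex.exp (Complex.I * ↑(t * h x))‖ = 1 := fun x => by
    rw [mul_comm]; exact Complex.norm_exp_ofReal_mul_I _
  -- Convexity makes the weight nonnegative, so its integral is exact. The term `1 / h' b` then
  -- cancels one boundary term, which leaves `2 / h' a`.
  have hbound : ‖∫ x in a..b, Complex.exp (Complex.I * ↑(t * h x)) * ↑(h'' x / h' x ^ 2)‖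
      ≤ (h' a)⁻¹ - (h' b)⁻¹ := by
    have h1 := intervalIntegral.norm_integral_le_integral_norm hab (μ := volume)
      (f := fun x => Complex.exp (Complex.I * ↑(t * h x)) * ↑(h'' x / h' x ^ 2))
    refine h1.trans (le_of_eq ?_)
    rw [show (h' a)⁻¹ - (h' b)⁻¹ = -(h' b)⁻¹ - -(h' a)⁻¹ by ring, ← hreal]
    refine intervalIntegral.integral_congr fun x hx => ?_
    have := div_nonneg (hconv x (hu ▸ hx)) (sq_nonneg (h' x))
    simp only [norm_mul, hn, one_mul, Complex.norm_real, Real.norm_eq_abs, abs_of_nonneg this]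
  have ha := hpos a ⟨le_rfl, hab⟩
  have hb := hpos b ⟨hab, le_rfl⟩
  have hmain : t * ‖∫ x in a..b, Complex.exp (Complex.I * ↑(t * h x))‖ ≤ 2 * (h' a)⁻¹ := by
    have : Complex.I * t * ∫ x in a..b, Complex.exp (Complex.I * ↑(t * h x)) =
        (∫ x in a..b, Complex.exp (Complex.I * ↑(t * h x)) * ↑(h'' x / h' x ^ 2)) -
        (Complex.exp (Complex.I * ↑(t * h b)) * ↑(-(h' b)⁻¹) -
          Complex.exp (Complex.I * ↑(t * h a)) * ↑(-(h' a)⁻¹)) := by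
      rw [← hint]; ring
    have hnorm := congrArg norm this
    rw [norm_mul, norm_mul, Complex.norm_I, one_mul, Complex.norm_real, Real.norm_eq_abs,
      abs_of_pos ht] at hnorm
    rw [hnorm]
    have e1 : ‖Complex.exp (Complex.I * ↑(t * h b)) * ↑(-(h' b)⁻¹)‖ = (h' b)⁻¹ := by
      rw [norm_mul, hn, one_mul, Complex.norm_real, Real.norm_eq_abs, abs_neg,
        abs_of_pos (inv_pos.2 hb)]
    have e2 : ‖Complex.exp (Complex.I * ↑(t * h a)) * ↑(-(h' a)⁻¹)‖ = (h' a)⁻¹ := by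
      rw [norm_mul, hn, one_mul, Complex.norm_real, Real.norm_eq_abs, abs_neg,
        abs_of_pos (inv_pos.2 ha)]
    refine (norm_sub_le _ _).trans ?_
    have := norm_sub_le (Complex.exp (Complex.I * ↑(t * h b)) * ↑(-(h' b)⁻¹))
      (Complex.exp (Complex.I * ↑(t * h a)) * ↑(-(h' a)⁻¹))
    linarith
  rw [le_div_iff₀ (by positivity)]
  calc _ = t * ‖∫ x in a..b, Complex.exp (Complex.I * ↑(t * h x))‖ * h' a := by ring
    _ ≤ 2 * (h' a)⁻¹ * h' a := by gcongr
    _ = 2 := by field_simp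

/-- The right side is the derivative of the phase `α u - H(u)`. It vanishes at `(1 + exp α)⁻¹` and
has slope `1 / u + 1 / (1 - u) ≥ 4`. -/
theorem four_mul_sub_le_log {α u : ℝ} (hu : (1 + Real.exp α)⁻¹ ≤ u) (hu1 : u < 1) :
    4 * (u - (1 + Real.exp α)⁻¹) ≤ α + Real.log u - Real.log (1 - u) := by
  set v := (1 + Real.exp α)⁻¹ with hv
  have hexp := Real.exp_pos α
  have hv0 : 0 < v := by positivity
  have hv1 : v < 1 := lt_of_le_of_lt hu hu1
  have hderiv : ∀ x ∈ Set.Ioo (0 : ℝ) 1, HasDerivAt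
      (fun x => Real.log x - Real.log (1 - x) - 4 * x) (1 / x + 1 / (1 - x) - 4) x := by
    intro x hx
    have h1 := Real.hasDerivAt_log hx.1.ne'
    have h2 := ((hasDerivAt_id x).const_sub 1).log (sub_pos.2 hx.2).ne'
    exact ((h1.sub h2).sub ((hasDerivAt_id x).const_mul 4)).congr_deriv (by
      simp only [id]; ring)
  have hmono : MonotoneOn (fun x => Real.log x - Real.log (1 - x) - 4 * x) (Set.Ioo 0 1) := by
    refine monotoneOn_of_deriv_nonneg (convex_Ioo 0 1)
      (fun x hx => (hderiv x hx).continuousAt.continuousWithinAt)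
      (fun x hx => ?_) (fun x hx => ?_)
    · rw [interior_Ioo] at hx
      exact (hderiv x hx).differentiableAt.differentiableWithinAt
    · rw [interior_Ioo] at hx
      rw [(hderiv x hx).deriv]
      have hx0 := hx.1
      have hx1 := sub_pos.2 hx.2
      rw [div_add_div _ _ hx0.ne' hx1.ne', sub_nonneg, le_div_iff₀ (by positivity)]
      nlinarith [sq_nonneg (2 * x - 1)]
  have hzero : Real.log v - Real.log (1 - v) = -α := by
    rw [← Real.log_div hv0.ne' (sub_pos.2 hv1).ne', ← Real.log_exp (-α)]
    congr 1
    rw [hv, Real.exp_neg]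
    field_simp
    ring
  have := hmono ⟨hv0, hv1⟩ ⟨hv0.trans_le hu, hu1⟩ hu
  simp only at this
  linarith

theorem norm_exp_I_mul_ofReal (x : ℝ) : ‖Complex.exp (Complex.I * (x : ℂ))‖ = 1 := by
  rw [mul_comm]; exact Complex.norm_exp_ofReal_mul_I _

theorem norm_integral_exp_I_mul_ofReal_le {a b : ℝ} (hab : a ≤ b) (g : ℝ → ℝ) :
    ‖∫ u in a..b, Complex.exp (Complex.I * ↑(g u))‖ ≤ b - a := by
  have := intervalIntegral.norm_integral_le_of_norm_le_const (a := a) (b := b) (C := 1)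
    (f := fun u => Complex.exp (Complex.I * ↑(g u))) fun x _ => (norm_exp_I_mul_ofReal _).le
  rwa [one_mul, abs_of_nonneg (sub_nonneg.2 hab)] at this

/-- The lower limit is the stationary point. Pieces of length `δ` next to it and next to the
logarithmic singularity at `1` are estimated trivially; between them the phase derivative is at
least `4 δ`. -/
theorem norm_integral_exp_binEntropy_half_le (α : ℝ) {t δ : ℝ} (ht : 0 < t) (hδ : 0 < δ) :
    ‖∫ u in (1 + Real.exp α)⁻¹..1, Complex.exp (Complex.I * ↑(t * (α * u - Real.binEntropy u)))‖
      ≤ 2 * δ + 1 / (2 * t * δ) := by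
  set v := (1 + Real.exp α)⁻¹ with hv
  have hexp := Real.exp_pos α
  have hv0 : 0 < v := by positivity
  have hv1 : v < 1 := inv_lt_one_of_one_lt₀ (by linarith)
  have hrest : 0 ≤ 1 / (2 * t * δ) := by positivity
  rcases lt_or_ge 1 (v + 2 * δ) with hlt | hle
  · exact (norm_integral_exp_I_mul_ofReal_le hv1.le _).trans (by linarith)
  have hcont : Continuous fun u =>
      Complex.exp (Complex.I * ↑(t * (α * u - Real.binEntropy u))) := by fun_prop
  have hsplit : ∫ u in v..1, Complex.exp (Complex.I * ↑(t * (α * u - Real.binEntropy u))) =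
      (∫ u in v..(v + δ), Complex.exp (Complex.I * ↑(t * (α * u - Real.binEntropy u)))) +
      (∫ u in (v + δ)..(1 - δ), Complex.exp (Complex.I * ↑(t * (α * u - Real.binEntropy u)))) +
      (∫ u in (1 - δ)..1, Complex.exp (Complex.I * ↑(t * (α * u - Real.binEntropy u)))) := by
    rw [intervalIntegral.integral_add_adjacent_intervals,
      intervalIntegral.integral_add_adjacent_intervals] <;> exact hcont.intervalIntegrable _ _
  have h1 := norm_integral_exp_I_mul_ofReal_le (show v ≤ v + δ by linarith)
    fun u => t * (α * u - Real.binEntropy u)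
  have h3 := norm_integral_exp_I_mul_ofReal_le (show 1 - δ ≤ 1 by linarith)
    fun u => t * (α * u - Real.binEntropy u)
  have hmem : ∀ x ∈ Set.Icc (v + δ) (1 - δ), 0 < x ∧ 0 < 1 - x := fun x hx =>
    ⟨by linarith [hx.1], by linarith [hx.2]⟩
  have hge : ∀ x ∈ Set.Icc (v + δ) (1 - δ),
      4 * δ ≤ α + Real.log x - Real.log (1 - x) := fun x hx => by
    have := four_mul_sub_le_log (α := α) (u := x) (by linarith [hx.1]) (by linarith [hx.2])
    linarith [hx.1]
  have h2 := norm_integral_exp_le_of_convex (a := v + δ) (b := 1 - δ) (t := t)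
    (h := fun u => α * u - Real.binEntropy u)
    (h' := fun u => α + Real.log u - Real.log (1 - u)) (h'' := fun u => 1 / u + 1 / (1 - u))
    (by linarith) ht
    (fun x hx => by
      obtain ⟨hx0, hx1⟩ := hmem x hx
      exact (((hasDerivAt_id x).const_mul α).sub
        (Real.hasDerivAt_binEntropy hx0.ne' (sub_pos.1 hx1).ne)).congr_deriv (by ring))
    (fun x hx => by
      obtain ⟨hx0, hx1⟩ := hmem x hx
      exact (((Real.hasDerivAt_log hx0.ne').const_add α).sub
        (((hasDerivAt_id x).const_sub 1).log hx1.ne')).congr_deriv (by simp only [id]; ring))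
    (fun x hx => by
      obtain ⟨hx0, hx1⟩ := hmem x hx
      have := hx0.ne'
      have := hx1.ne'
      fun_prop (disch := assumption))
    (fun x hx => lt_of_lt_of_le (by positivity) (hge x hx))
    (fun x hx => by
      obtain ⟨hx0, hx1⟩ := hmem x hx
      positivity)
  have h2' : 2 / (t * (α + Real.log (v + δ) - Real.log (1 - (v + δ)))) ≤ 1 / (2 * t * δ) := by
    calc _ ≤ 2 / (t * (4 * δ)) := by
          gcongr
          exact hge _ ⟨le_rfl, by linarith⟩
      _ = _ := by field_simp; norm_num
  rw [hsplit]
  refine (norm_add₃_le).trans ?_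
  linarith

/-- The symmetry of the entropy under `u ↦ 1 - u` turns the part left of the stationary point into a
right part with slope `-α`. Taking `δ = 1 / √t` gives `5 / 2 / √t` for each. Uniformity in `α` is
the point. -/
theorem norm_integral_exp_binEntropy_le (α : ℝ) {t : ℝ} (ht : 0 < t) :
    ‖∫ u in (0 : ℝ)..1, Complex.exp (Complex.I * ↑(t * (α * u - Real.binEntropy u)))‖
      ≤ 5 / Real.sqrt t := by
  have hcont : ∀ β : ℝ, Continuous fun u =>
      Complex.exp (Complex.I * ↑(t * (β * u - Real.binEntropy u))) := fun β => by fun_prop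
  set v := (1 + Real.exp α)⁻¹ with hv
  have hv' : 1 - v = (1 + Real.exp (-α))⁻¹ := by
    have := Real.exp_pos α
    rw [hv, Real.exp_neg]
    field_simp
    ring
  have hleft : ∫ u in (0 : ℝ)..v, Complex.exp (Complex.I * ↑(t * (α * u - Real.binEntropy u))) =
      Complex.exp (Complex.I * ↑(t * α)) * ∫ u in (1 + Real.exp (-α))⁻¹..1,
        Complex.exp (Complex.I * ↑(t * (-α * u - Real.binEntropy u))) := by
    have := intervalIntegral.integral_comp_sub_left (a := 0) (b := v) (fun u =>
      Complex.exp (Complex.I * ↑(t * (α * (1 - u) - Real.binEntropy u)))) 1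
    simp only [sub_sub_cancel, Real.binEntropy_one_sub, sub_zero] at this
    rw [this, hv', ← intervalIntegral.integral_const_mul]
    refine intervalIntegral.integral_congr fun u _ => ?_
    rw [← Complex.exp_add]
    congr 1
    push_cast
    ring
  have hs := Real.sqrt_pos.2 ht
  have key : ∀ β : ℝ, ‖∫ u in (1 + Real.exp β)⁻¹..1,
      Complex.exp (Complex.I * ↑(t * (β * u - Real.binEntropy u)))‖ ≤ 5 / 2 / Real.sqrt t := by
    intro β
    refine (norm_integral_exp_binEntropy_half_le β ht (inv_pos.2 hs)).trans (le_of_eq ?_)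
    nth_rewrite 2 [← Real.mul_self_sqrt ht.le]
    field_simp
    norm_num
  rw [← intervalIntegral.integral_add_adjacent_intervals
    ((hcont α).intervalIntegrable 0 v) ((hcont α).intervalIntegrable v 1)]
  refine (norm_add_le _ _).trans ?_
  rw [hleft, norm_mul, norm_exp_I_mul_ofReal, one_mul]
  calc _ ≤ 5 / 2 / Real.sqrt t + 5 / 2 / Real.sqrt t := add_le_add (key _) (key _)
    _ = _ := by ring

/-! ### Decay of characteristic functions of solutions of the distributional equation -/

/-- The distributional equation `X = U X' + (1 - U) X'' + U - H(U)` (with `U` uniform on `[0, 1]`,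
`X'` and `X''` distributed like `X`, all independent, and `H` the binary entropy), in terms of
characteristic functions. -/
def SolvesSplittingEquation (ν : Measure ℝ) : Prop :=
  ∀ t : ℝ, charFun ν t = ∫ u in (0 : ℝ)..1, charFun ν (u * t) * charFun ν ((1 - u) * t) *
    Complex.exp (Complex.I * ↑(t * (u - Real.binEntropy u)))

namespace SolvesSplittingEquation

variable {ν : Measure ℝ} [IsProbabilityMeasure ν]

/-- By Fubini, `u` can be integrated first with `X' = p.1` and `X'' = p.2` frozen. The phase then
has slope `X' - X'' + 1`, over which there is no control and none is needed. -/
theorem charFun_eq_integral_integral (hν : SolvesSplittingEquation ν) (t : ℝ) :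
    charFun ν t = ∫ p : ℝ × ℝ, (∫ u in (0 : ℝ)..1, Complex.exp (Complex.I * ↑(t * p.2)) *
      Complex.exp (Complex.I * ↑(t * ((p.1 - p.2 + 1) * u - Real.binEntropy u)))) ∂(ν.prod ν) := by
  have hcont : Continuous fun q : ℝ × (ℝ × ℝ) => Complex.exp (Complex.I * ↑(t * q.2.2)) *
      Complex.exp (Complex.I * ↑(t * ((q.2.1 - q.2.2 + 1) * q.1 - Real.binEntropy q.1))) := by
    fun_prop
  rw [hν t]
  simp only [intervalIntegral.integral_of_le zero_le_one]
  rw [← integral_integral_swap]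
  · refine integral_congr_ae (Eventually.of_forall fun u => ?_)
    simp only [charFun_apply_real]
    rw [← integral_prod_mul, ← integral_mul_const]
    refine integral_congr_ae (Eventually.of_forall fun p => ?_)
    simp only
    rw [← Complex.exp_add, ← Complex.exp_add, ← Complex.exp_add]
    congr 1
    push_cast
    ring
  · refine Integrable.of_bound hcont.aestronglyMeasurable 1 (Eventually.of_forall fun q => ?_)
    simp only [Function.uncurry]
    rw [norm_mul, norm_exp_I_mul_ofReal, norm_exp_I_mul_ofReal, one_mul]

theorem norm_charFun_le_div_sqrt (hν : SolvesSplittingEquation ν) {t : ℝ} (ht : 0 < t) :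
    ‖charFun ν t‖ ≤ 5 / √t := by
  rw [hν.charFun_eq_integral_integral]
  have := norm_integral_le_of_norm_le_const (μ := ν.prod ν) (C := 5 / √t) (f := fun p : ℝ × ℝ =>
      ∫ u in (0 : ℝ)..1, Complex.exp (Complex.I * ↑(t * p.2)) *
        Complex.exp (Complex.I * ↑(t * ((p.1 - p.2 + 1) * u - Real.binEntropy u))))
    (Eventually.of_forall fun p => by
      rw [intervalIntegral.integral_const_mul, norm_mul, norm_exp_I_mul_ofReal, one_mul]
      exact norm_integral_exp_binEntropy_le _ ht)
  simpa using this

/-- Bootstrap: in the splitting equation the smaller argument gets the bound `5 / √(u t)`, whose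
singularity is integrable, and the larger one, at least `t / 2`, gets the induction hypothesis. -/
theorem exists_norm_charFun_le_div_sqrt_pow (hν : SolvesSplittingEquation ν) (k : ℕ) :
    ∃ C : ℝ, 0 ≤ C ∧ ∀ t : ℝ, 0 < t → ‖charFun ν t‖ ≤ C / √t ^ k := by
  induction k with
  | zero => exact ⟨1, zero_le_one, fun t _ => by simpa using norm_charFun_le_one t⟩
  | succ k ih =>
    obtain ⟨C, hC, hb⟩ := ih
    have hgi : IntervalIntegrable (fun u : ℝ => u ^ (-(1 / 2) : ℝ) + (1 - u) ^ (-(1 / 2) : ℝ))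
        volume 0 1 := by
      have h1 : IntervalIntegrable (fun u : ℝ => u ^ (-(1 / 2) : ℝ)) volume 0 1 :=
        intervalIntegral.intervalIntegrable_rpow' (by norm_num)
      refine h1.add ?_
      have := (h1.comp_sub_left 1).symm
      simpa using this
    refine ⟨5 * C * √2 ^ k * |∫ u in (0 : ℝ)..1, u ^ (-(1 / 2) : ℝ) + (1 - u) ^ (-(1 / 2) : ℝ)|,
      by positivity, fun t ht => ?_⟩
    have hst := Real.sqrt_pos.2 ht
    -- the contribution of a pair of arguments the second of which is not small
    have key : ∀ u : ℝ, 0 < u → u ≤ 1 / 2 → ‖charFun ν (u * t)‖ * ‖charFun ν ((1 - u) * t)‖ ≤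
        5 * C * √2 ^ k / √t ^ (k + 1) * u ^ (-(1 / 2) : ℝ) := by
      intro u hu hu2
      have hsu := Real.sqrt_pos.2 hu
      have hst2 : √(t / 2) ≤ √((1 - u) * t) := Real.sqrt_le_sqrt (by nlinarith)
      have hpos : 0 < √(t / 2) := Real.sqrt_pos.2 (by positivity)
      calc _ ≤ 5 / √(u * t) * (C / √(t / 2) ^ k) := by
            gcongr
            · exact hν.norm_charFun_le_div_sqrt (by positivity)
            · refine (hb _ (mul_pos (by linarith) ht)).trans ?_
              gcongr
        _ = _ := by
            rw [Real.rpow_neg hu.le, ← Real.sqrt_eq_rpow, Real.sqrt_mul hu.le,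
              Real.sqrt_div ht.le, div_pow, pow_succ]
            field_simp
    have hle := intervalIntegral.norm_integral_le_of_norm_le (μ := volume)
      (f := fun u => charFun ν (u * t) * charFun ν ((1 - u) * t) *
        Complex.exp (Complex.I * ↑(t * (u - Real.binEntropy u))))
      (g := fun u => 5 * C * √2 ^ k / √t ^ (k + 1) *
        (u ^ (-(1 / 2) : ℝ) + (1 - u) ^ (-(1 / 2) : ℝ))) zero_le_one
      (by
        have hne : ∀ᵐ u : ℝ, u ≠ 1 := by simp [ae_iff]
        filter_upwards [hne] with u hu1 hu
        have hu1 : u < 1 := lt_of_le_of_ne hu.2 hu1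
        have hA : 0 ≤ 5 * C * √2 ^ k / √t ^ (k + 1) := by positivity
        have hp1 : 0 ≤ 5 * C * √2 ^ k / √t ^ (k + 1) * u ^ (-(1 / 2) : ℝ) :=
          mul_nonneg hA (Real.rpow_nonneg hu.1.le _)
        have hp2 : 0 ≤ 5 * C * √2 ^ k / √t ^ (k + 1) * (1 - u) ^ (-(1 / 2) : ℝ) :=
          mul_nonneg hA (Real.rpow_nonneg (by linarith) _)
        rw [norm_mul, norm_mul, norm_exp_I_mul_ofReal, mul_one, mul_add]
        rcases le_total u (1 / 2) with h | h
        · linarith [key u hu.1 h]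
        · have := key (1 - u) (by linarith) (by linarith)
          rw [sub_sub_cancel, mul_comm] at this
          linarith)
      (hgi.const_mul _)
    rw [hν t]
    refine hle.trans ?_
    rw [intervalIntegral.integral_const_mul]
    refine (mul_le_mul_of_nonneg_left (le_abs_self _) (by positivity)).trans (le_of_eq ?_)
    ring

theorem exists_abs_pow_mul_norm_charFun_le (hν : SolvesSplittingEquation ν) (k : ℕ) :
    ∃ C : ℝ, ∀ t : ℝ, |t| ^ k * ‖charFun ν t‖ ≤ C := by
  obtain ⟨C, hC, hb⟩ := hν.exists_norm_charFun_le_div_sqrt_pow (2 * k)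
  have hpos : ∀ t : ℝ, 0 < t → |t| ^ k * ‖charFun ν t‖ ≤ C := by
    intro t ht
    have := hb t ht
    rw [pow_mul, Real.sq_sqrt ht.le, le_div_iff₀ (by positivity)] at this
    rwa [abs_of_pos ht, mul_comm]
  refine ⟨max C 1, fun t => ?_⟩
  rcases lt_trichotomy t 0 with h | h | h
  · have := hpos (-t) (by linarith)
    rw [charFun_neg, RCLike.norm_conj, abs_neg] at this
    exact this.trans (le_max_left _ _)
  · refine le_trans ?_ (le_max_right _ _)
    rw [h, abs_zero]
    exact mul_le_one₀ (pow_le_one₀ le_rfl zero_le_one) (norm_nonneg _) (norm_charFun_le_one _)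
  · exact (hpos t h).trans (le_max_left _ _)

end SolvesSplittingEquation

/-! ### Measures with a Schwartz density -/

/-- Landau's inequality: a difference quotient with step `h` approximates the derivative up to an
error controlled by the second derivative. The step stays free to be chosen. -/
theorem norm_deriv_le_of_norm_deriv2_le {g g' g'' : ℝ → ℂ} {M : ℝ}
    (hg : ∀ x, HasDerivAt g (g' x) x) (hg' : ∀ x, HasDerivAt g' (g'' x) x)
    (hM : ∀ x, ‖g'' x‖ ≤ M) (t h : ℝ) (hh : h ≠ 0) :
    ‖g' t‖ ≤ (‖g (t + h)‖ + ‖g t‖) / |h| + M * |h| := by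
  have hlip : ∀ x y, ‖g' y - g' x‖ ≤ M * ‖y - x‖ := fun x y =>
    convex_univ.norm_image_sub_le_of_norm_hasDerivWithin_le
      (fun z _ => (hg' z).hasDerivWithinAt) (fun z _ => hM z) trivial trivial
  have hM0 : 0 ≤ M := (norm_nonneg _).trans (hM 0)
  have hmv : ‖(g (t + h) - (t + h) • g' t) - (g t - t • g' t)‖ ≤ M * |h| * ‖t + h - t‖ := by
    refine (convex_uIcc t (t + h)).norm_image_sub_le_of_norm_hasDerivWithin_le
      (f := fun x => g x - x • g' t) (f' := fun x => g' x - g' t)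
      (fun z _ => ?_) (fun z hz => ?_) Set.left_mem_uIcc Set.right_mem_uIcc
    · have := (hg z).sub ((hasDerivAt_id z).smul_const (g' t))
      simp only [one_smul] at this
      exact this.hasDerivWithinAt
    · refine (hlip t z).trans ?_
      have := Set.abs_sub_left_of_mem_uIcc hz
      rw [add_sub_cancel_left] at this
      rw [Real.norm_eq_abs]
      gcongr
  have hpos := abs_pos.2 hh
  have heq : h • g' t = (g (t + h) - g t) -
      ((g (t + h) - (t + h) • g' t) - (g t - t • g' t)) := by
    simp only [Complex.real_smul]
    push_cast
    ring
  have hn : |h| * ‖g' t‖ ≤ (‖g (t + h)‖ + ‖g t‖) + M * |h| * |h| := by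
    calc |h| * ‖g' t‖ = ‖h • g' t‖ := by rw [norm_smul, Real.norm_eq_abs]
      _ ≤ _ := by
        rw [heq]
        refine (norm_sub_le _ _).trans (add_le_add (norm_sub_le _ _) ?_)
        simpa using hmv
  rw [div_add' _ _ _ hpos.ne', le_div_iff₀ hpos]
  linarith

/-- A rapidly decreasing function with bounded first and second derivatives has a rapidly
decreasing derivative. -/
theorem rapidly_decreasing_deriv {g g' g'' : ℝ → ℂ} {M M' : ℝ}
    (hg : ∀ x, HasDerivAt g (g' x) x) (hg' : ∀ x, HasDerivAt g' (g'' x) x)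
    (hM : ∀ x, ‖g'' x‖ ≤ M) (hM' : ∀ x, ‖g' x‖ ≤ M')
    (hd : ∀ k : ℕ, ∃ C : ℝ, ∀ t : ℝ, |t| ^ k * ‖g t‖ ≤ C) (k : ℕ) :
    ∃ C : ℝ, ∀ t : ℝ, |t| ^ k * ‖g' t‖ ≤ C := by
  obtain ⟨C, hC⟩ := hd (2 * k)
  have hM0 : 0 ≤ M := (norm_nonneg _).trans (hM 0)
  refine ⟨max M' (2 * C + M), fun t => ?_⟩
  rcases le_total |t| 1 with h1 | h1
  · refine le_trans ?_ (le_max_left _ _)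
    exact (mul_le_of_le_one_left (norm_nonneg _) (pow_le_one₀ (abs_nonneg _) h1)).trans (hM' t)
  · refine le_trans ?_ (le_max_right _ _)
    have ht : 0 < |t| := by linarith
    have ht0 : t ≠ 0 := abs_pos.1 ht
    -- A step of size `|t| ^ (-k)` makes the second derivative term small enough, while decay of
    -- order `2 k` pays for the division by it. Stepping away from the origin keeps that decay
    -- available at the shifted point.
    set r := (|t| ^ k)⁻¹ with hr
    have hr0 : 0 < r := by positivity
    have hsign : |SignType.sign t * r| = r := by
      rw [abs_mul, abs_of_pos hr0]
      rcases lt_or_gt_of_ne ht0 with h | h <;> simp [h]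
    have hb := norm_deriv_le_of_norm_deriv2_le hg hg' hM t (SignType.sign t * r)
      (by rw [← abs_pos, hsign]; exact hr0)
    rw [hsign] at hb
    have hfar : |t| ≤ |t + SignType.sign t * r| := by
      rcases lt_or_gt_of_ne ht0 with h | h
      · simp only [h, sign_neg, SignType.coe_neg_one]
        rw [abs_of_neg h, abs_of_neg (by linarith)]
        linarith
      · simp only [h, sign_pos, SignType.coe_one]
        rw [abs_of_pos h, abs_of_pos (by linarith)]
        linarith
    have h2 : |t| ^ (2 * k) * ‖g (t + SignType.sign t * r)‖ ≤ C := by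
      refine le_trans ?_ (hC (t + SignType.sign t * r))
      gcongr
    have h3 := hC t
    have hk : |t| ^ k * r = 1 := mul_inv_cancel₀ (by positivity)
    calc |t| ^ k * ‖g' t‖
        ≤ |t| ^ k * ((‖g (t + SignType.sign t * r)‖ + ‖g t‖) / r + M * r) := by gcongr
      _ = |t| ^ (2 * k) * ‖g (t + SignType.sign t * r)‖ + |t| ^ (2 * k) * ‖g t‖
          + M * (|t| ^ k * r) := by
          rw [mul_comm 2 k, pow_mul, div_eq_mul_inv, hr, inv_inv]; ring
      _ ≤ 2 * C + M := by rw [hk]; linarith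

variable {ν : Measure ℝ} [IsProbabilityMeasure ν]

/-- The characteristic function of a measure with moments of all orders is a Schwartz function as
soon as it is rapidly decreasing. -/
theorem exists_schwartzMap_eq_charFun (hmom : ∀ k : ℕ, MemLp id k ν)
    (hd : ∀ k : ℕ, ∃ C : ℝ, ∀ t : ℝ, |t| ^ k * ‖charFun ν t‖ ≤ C) :
    ∃ φ : SchwartzMap ℝ ℂ, ∀ t, φ t = charFun ν t := by
  have hsm : ContDiff ℝ ((⊤ : ℕ∞) : WithTop ℕ∞) (charFun ν) := contDiff_charFun' hmom
  have hbd : ∀ n : ℕ, ∃ M, ∀ t, ‖iteratedDeriv n (charFun ν) t‖ ≤ M := by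
    intro n
    refine ⟨∫ x, |x| ^ n ∂ν, fun t => ?_⟩
    rw [iteratedDeriv_charFun (hmom n), norm_mul, norm_pow, Complex.norm_I, one_pow, one_mul]
    refine (norm_integral_le_integral_norm _).trans (le_of_eq (integral_congr_ae
      (Eventually.of_forall fun x => ?_)))
    simp only
    rw [norm_mul, norm_pow, Complex.norm_real, Real.norm_eq_abs, ← Complex.ofReal_mul,
      Complex.norm_exp_ofReal_mul_I, mul_one]
  have hder : ∀ (n : ℕ) (x : ℝ), HasDerivAt (iteratedDeriv n (charFun ν))
      (iteratedDeriv (n + 1) (charFun ν) x) x := by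
    intro n x
    rw [iteratedDeriv_succ]
    exact (hsm.differentiable_iteratedDeriv n (by exact_mod_cast ENat.natCast_lt_top n)
      x).hasDerivAt
  have hdec : ∀ n k : ℕ, ∃ C : ℝ, ∀ t : ℝ, |t| ^ k * ‖iteratedDeriv n (charFun ν) t‖ ≤ C := by
    intro n
    induction n with
    | zero => simpa using hd
    | succ n ih =>
      obtain ⟨M, hM⟩ := hbd (n + 2)
      obtain ⟨M', hM'⟩ := hbd (n + 1)
      exact rapidly_decreasing_deriv (hder n) (hder (n + 1)) hM hM' ih
  exact ⟨⟨charFun ν, hsm, fun k n => by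
    simpa only [norm_iteratedFDeriv_eq_norm_iteratedDeriv, Real.norm_eq_abs] using hdec n k⟩,
    fun _ => rfl⟩

open scoped FourierTransform in
/-- A measure whose characteristic function is a Schwartz function is, up to the sign of the
density, given by a Schwartz density. -/
theorem exists_schwartzMap_integral_eq_charFun {ρ : Measure ℝ} {φ : SchwartzMap ℝ ℂ}
    (hφ : ∀ t, φ t = charFun ρ t) :
    ∃ f : SchwartzMap ℝ ℝ, ∀ t : ℝ,
      ∫ x : ℝ, Complex.exp (t * x * Complex.I) * (f x : ℂ) = charFun ρ t := by
  have hpi : (2 * Real.pi) ≠ 0 := by positivity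
  -- The dilation by `2 π` reconciles the conventions of `charFun` and `𝓕`.
  let ψ : SchwartzMap ℝ ℂ := SchwartzMap.compCLMOfContinuousLinearEquiv ℂ
    (ContinuousLinearEquiv.unitsEquivAut ℝ (Units.mk0 (2 * Real.pi) hpi)) φ
  have hψ : ∀ w, ψ w = charFun ρ (w * (2 * Real.pi)) := fun w => hφ _
  let F : SchwartzMap ℝ ℂ := 𝓕 ψ
  have hF : ∀ t : ℝ, ∫ x : ℝ, Complex.exp (t * x * Complex.I) * F x = charFun ρ t := by
    intro t
    have h1 : (𝓕⁻ F) (t / (2 * Real.pi)) = ψ (t / (2 * Real.pi)) := by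
      rw [FourierTransform.fourierInv_fourier_eq]
    rw [hψ, div_mul_cancel₀ _ hpi, SchwartzMap.fourierInv_coe, Real.fourierInv_eq'] at h1
    rw [← h1]
    refine integral_congr_ae (Eventually.of_forall fun x => ?_)
    simp only [smul_eq_mul]
    congr 2
    have : (Real.pi : ℂ) ≠ 0 := by exact_mod_cast Real.pi_ne_zero
    simp
    field_simp
  have hFi : ∀ t : ℝ, Integrable fun x : ℝ => Complex.exp (t * x * Complex.I) * F x := by
    intro t
    refine F.integrable.bdd_mul (c := 1) (by fun_prop) (Eventually.of_forall fun x => ?_)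
    rw [← Complex.ofReal_mul, Complex.norm_exp_ofReal_mul_I]
  refine ⟨SchwartzMap.postcompCLM Complex.reCLM F, fun t => ?_⟩
  -- Since `charFun ρ (-t)` is conjugate to `charFun ρ t`, the conjugate of `F` has the same
  -- transform, and hence so does the real part of `F`.
  have hconj : ∫ x : ℝ, Complex.exp (t * x * Complex.I) * (starRingEnd ℂ) (F x) =
      charFun ρ t := by
    have h1 := congrArg (starRingEnd ℂ) (hF (-t))
    rw [← integral_conj, charFun_neg, Complex.conj_conj] at h1
    rw [← h1]
    refine integral_congr_ae (Eventually.of_forall fun x => ?_)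
    simp [← Complex.exp_conj]
  have hci : Integrable fun x : ℝ =>
      Complex.exp (t * x * Complex.I) * (starRingEnd ℂ) (F x) := by
    refine (hFi t).norm.mono' ?_ (Eventually.of_forall fun x => ?_)
    · exact (by fun_prop : Continuous fun x : ℝ =>
        Complex.exp (t * x * Complex.I) * (starRingEnd ℂ) (F x)).aestronglyMeasurable
    · simp
  calc ∫ x : ℝ, Complex.exp (t * x * Complex.I) * ((SchwartzMap.postcompCLM Complex.reCLM F x : ℝ) : ℂ)
      = ∫ x : ℝ, (1 / 2 : ℂ) * (Complex.exp (t * x * Complex.I) * F x +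
          Complex.exp (t * x * Complex.I) * (starRingEnd ℂ) (F x)) := by
        refine integral_congr_ae (Eventually.of_forall fun x => ?_)
        simp only [SchwartzMap.postcompCLM_apply, Complex.reCLM_apply, Complex.re_eq_add_conj]
        ring
    _ = _ := by
        rw [integral_const_mul, integral_add (hFi t) hci, hF, hconj]
        ring

theorem charFun_withDensity_ofReal {g : ℝ → ℝ} (hg : Continuous g) (t : ℝ) :
    charFun ((volume : Measure ℝ).withDensity fun x => ENNReal.ofReal (g x)) t =
      ∫ x : ℝ, Complex.exp (t * x * Complex.I) * ((max (g x) 0 : ℝ) : ℂ) := by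
  rw [charFun_apply_real, integral_withDensity_eq_integral_toReal_smul
    (by fun_prop) (Eventually.of_forall fun _ => ENNReal.ofReal_lt_top)]
  refine integral_congr_ae (Eventually.of_forall fun x => ?_)
  simp only [ENNReal.toReal_ofReal', Complex.real_smul]
  ring

/-- A probability measure whose characteristic function is the Fourier transform of a real Schwartz
function has that function as its density. -/
theorem hasSchwartzDensity_of_integral_eq_charFun {f : SchwartzMap ℝ ℝ}
    (hf : ∀ t : ℝ, ∫ x : ℝ, Complex.exp (t * x * Complex.I) * (f x : ℂ) = charFun ν t) :
    HasSchwartzDensity ν := by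
  set p := (volume : Measure ℝ).withDensity fun x => ENNReal.ofReal (f x) with hp
  set m := (volume : Measure ℝ).withDensity fun x => ENNReal.ofReal (-f x) with hm
  have hfp : Integrable fun x => max (f x) 0 := f.integrable.pos_part
  have hfm : Integrable fun x => max (-f x) 0 := f.integrable.neg_part
  have : IsFiniteMeasure p := isFiniteMeasure_withDensity_ofReal f.integrable.2
  have : IsFiniteMeasure m := isFiniteMeasure_withDensity_ofReal f.integrable.neg.2
  have hei : ∀ (t : ℝ) {g : ℝ → ℝ}, Integrable g →
      Integrable fun x : ℝ => Complex.exp (t * x * Complex.I) * (g x : ℂ) := by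
    intro t g hg
    refine hg.ofReal.bdd_mul (c := 1) (by fun_prop) (Eventually.of_forall fun x => ?_)
    rw [← Complex.ofReal_mul, Complex.norm_exp_ofReal_mul_I]
  have hbi : ∀ (t : ℝ) (ρ : Measure ℝ) [IsFiniteMeasure ρ],
      Integrable (fun x : ℝ => Complex.exp (t * x * Complex.I)) ρ := by
    intro t ρ _
    refine Integrable.of_bound (by fun_prop) 1 (Eventually.of_forall fun x => ?_)
    rw [← Complex.ofReal_mul, Complex.norm_exp_ofReal_mul_I]
  -- The sign of `f` is not yet known. Moving the negative part to the other side gives finite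
  -- positive measures, to which uniqueness of characteristic functions applies.
  have heq : ν + m = p := by
    refine Measure.ext_of_charFun (funext fun t => ?_)
    have hadd : charFun (ν + m) t = charFun ν t + charFun m t := by
      simp only [charFun_apply_real]
      exact integral_add_measure (hbi t ν) (hbi t m)
    rw [hadd, ← hf t, hm, hp, charFun_withDensity_ofReal (by fun_prop),
      charFun_withDensity_ofReal (by fun_prop), ← integral_add (hei t f.integrable) (hei t hfm)]
    refine integral_congr_ae (Eventually.of_forall fun x => ?_)
    simp only
    rw [← mul_add, ← Complex.ofReal_add]
    congr 2
    rcases le_total 0 (f x) with h | h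
    · rw [max_eq_right (by linarith), max_eq_left h, add_zero]
    · rw [max_eq_left (by linarith), max_eq_right h, add_neg_cancel]
  -- This set is null for `p`, hence for the smaller measure `m`, whose density is positive there.
  -- So it is Lebesgue null, and being open it is empty.
  have hopen : IsOpen {x | f x < 0} := isOpen_lt f.continuous continuous_const
  have hp0 : p {x | f x < 0} = 0 := by
    rw [hp, withDensity_apply_eq_zero (by fun_prop)]
    refine measure_mono_null (t := ∅) (fun x hx => ?_) measure_empty
    exact absurd (ENNReal.ofReal_of_nonpos hx.2.le) hx.1
  have hm0 : m {x | f x < 0} = 0 := by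
    rw [← heq, Measure.add_apply] at hp0
    exact (add_eq_zero.1 hp0).2
  have hv0 : (volume : Measure ℝ) {x | f x < 0} = 0 := by
    rw [hm, withDensity_apply_eq_zero (by fun_prop)] at hm0
    refine measure_mono_null (fun x hx => Set.mem_inter ?_ hx) hm0
    have : 0 < -f x := neg_pos.2 hx
    simpa using this
  have hnonneg : ∀ x, 0 ≤ f x := by
    intro x
    by_contra hx
    have := (hopen.measure_eq_zero_iff volume).1 hv0
    exact absurd (show x ∈ {x | f x < 0} from not_le.1 hx) (by rw [this]; exact id)
  have hmz : m = 0 := by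
    have : (fun x => ENNReal.ofReal (-f x)) = 0 := funext fun x =>
      ENNReal.ofReal_of_nonpos (neg_nonpos.2 (hnonneg x))
    rw [hm, this, withDensity_zero]
  exact ⟨f, hnonneg, by rw [← heq.trans hp, hmz, add_zero]⟩

theorem SolvesSplittingEquation.hasSchwartzDensity (hν : SolvesSplittingEquation ν)
    (hmom : ∀ k : ℕ, MemLp id k ν) : HasSchwartzDensity ν := by
  obtain ⟨φ, hφ⟩ := exists_schwartzMap_eq_charFun hmom hν.exists_abs_pow_mul_norm_charFun_le
  obtain ⟨f, hf⟩ := exists_schwartzMap_integral_eq_charFun hφ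
  exact hasSchwartzDensity_of_integral_eq_charFun hf

/-! ### Depths in a recursive tree -/

/-- The depth of the vertex `v` in the recursive tree in which the parent of `i + 1` is `k i`. -/
def vertexDepth (k : ∀ i : ℕ, Fin (i + 1)) : ℕ → ℕ
  | 0 => 0
  | i + 1 => vertexDepth k (k i) + 1
  termination_by n => n
  decreasing_by exact (k i).isLt

theorem vertexDepth_zero (k : ∀ i : ℕ, Fin (i + 1)) : vertexDepth k 0 = 0 := by
  rw [vertexDepth]

theorem vertexDepth_succ (k : ∀ i : ℕ, Fin (i + 1)) (i : ℕ) :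
    vertexDepth k (i + 1) = vertexDepth k (k i) + 1 := by
  rw [vertexDepth]

theorem vertexDepth_congr {k k' : ∀ i : ℕ, Fin (i + 1)} {v : ℕ} (h : ∀ i < v, k i = k' i) :
    vertexDepth k v = vertexDepth k' v := by
  induction v using Nat.strong_induction_on with
  | _ v ih =>
    cases v with
    | zero => rw [vertexDepth_zero, vertexDepth_zero]
    | succ i =>
      have h1 := (k' i).isLt
      rw [vertexDepth_succ, vertexDepth_succ, h i (Nat.lt_succ_self i),
        ih _ h1 fun j hj => h j (by omega)]

/-- Adjacent vertices are parent and child, so depth rises by at most one per edge. This is the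
lower bound for the graph distance. -/
theorem vertexDepth_le_length {k : ∀ i : ℕ, Fin (i + 1)} {n : ℕ} {u v : Fin (n + 1)}
    (p : (recursiveTree k n).Walk u v) : vertexDepth k v ≤ vertexDepth k u + p.length := by
  induction p with
  | nil => simp
  | @cons a b c hab _ ih =>
    have hstep : vertexDepth k b ≤ vertexDepth k a + 1 := by
      rw [recursiveTree, SimpleGraph.fromRel_adj] at hab
      rcases hab.2 with ⟨i, hi, hk⟩ | ⟨i, hi, hk⟩
      · rw [hi, vertexDepth_succ, hk]
      · rw [hi, vertexDepth_succ, hk]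
        omega
    rw [SimpleGraph.Walk.length_cons]
    omega

theorem exists_walk_length_eq_vertexDepth (k : ∀ i : ℕ, Fin (i + 1)) {n : ℕ} (v : Fin (n + 1)) :
    ∃ p : (recursiveTree k n).Walk 0 v, p.length = vertexDepth k v := by
  obtain ⟨v, hv⟩ := v
  induction v using Nat.strong_induction_on with
  | _ v ih =>
    cases v with
    | zero => exact ⟨SimpleGraph.Walk.nil, by simp [vertexDepth_zero]⟩
    | succ i =>
      have hk := (k i).isLt
      obtain ⟨p, hp⟩ := ih (k i) hk (by omega)
      have hadj : (recursiveTree k n).Adj ⟨k i, by omega⟩ ⟨i + 1, hv⟩ := by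
        rw [recursiveTree, SimpleGraph.fromRel_adj]
        refine ⟨fun h => ?_, Or.inl ⟨i, rfl, rfl⟩⟩
        have := congrArg Fin.val h
        simp only at this
        omega
      exact ⟨p.concat hadj, by rw [SimpleGraph.Walk.length_concat, hp, vertexDepth_succ]⟩

theorem dist_recursiveTree (k : ∀ i : ℕ, Fin (i + 1)) {n : ℕ} (v : Fin (n + 1)) :
    (recursiveTree k n).dist 0 v = vertexDepth k v := by
  obtain ⟨p, hp⟩ := exists_walk_length_eq_vertexDepth k v
  refine le_antisymm (hp ▸ SimpleGraph.dist_le p) ?_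
  obtain ⟨q, hq⟩ := p.reachable.exists_walk_length_eq_dist
  have := vertexDepth_le_length q
  simpa [vertexDepth_zero, hq] using this

theorem totalPathLength_recursiveTree (k : ∀ i : ℕ, Fin (i + 1)) (n : ℕ) :
    totalPathLength (recursiveTree k n) 0 = ∑ v ∈ Finset.range (n + 1), vertexDepth k v := by
  rw [totalPathLength, Finset.sum_range]
  exact Finset.sum_congr rfl fun v _ => dist_recursiveTree k v

/-! ### Averaging over the last choice -/

/-- `G` depends on the choices of the parents of the vertices `1, …, n` only. -/
def HistoryDetermined {Ω E : Type*} (K : ∀ i : ℕ, Ω → Fin (i + 1)) (n : ℕ) (G : Ω → E) : Prop :=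
  ∀ ω ω', (∀ i < n, K i ω = K i ω') → G ω = G ω'

/-- The σ-algebra generated by the choices of the parents of the vertices `1, …, n`. -/
abbrev attachmentHistory {Ω : Type*} (K : ∀ i : ℕ, Ω → Fin (i + 1)) (n : ℕ) : MeasurableSpace Ω :=
  ⨆ i ∈ Set.Iio n, MeasurableSpace.comap (K i) inferInstance

namespace HistoryDetermined

variable {Ω E : Type*} {K : ∀ i : ℕ, Ω → Fin (i + 1)} {n : ℕ} {G : Ω → E}

theorem mono {m : ℕ} (hG : HistoryDetermined K n G) (h : n ≤ m) : HistoryDetermined K m G :=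
  fun ω ω' hω => hG ω ω' fun i hi => hω i (hi.trans_le h)

theorem comp {E' : Type*} (hG : HistoryDetermined K n G) (Φ : E → E') :
    HistoryDetermined K n fun ω => Φ (G ω) :=
  fun ω ω' hω => congrArg Φ (hG ω ω' hω)

theorem comp₂ {E' E'' : Type*} {G' : Ω → E'} (hG : HistoryDetermined K n G)
    (hG' : HistoryDetermined K n G') (Φ : E → E' → E'') :
    HistoryDetermined K n fun ω => Φ (G ω) (G' ω) :=
  fun ω ω' hω => congrArg₂ Φ (hG ω ω' hω) (hG' ω ω' hω)

/-- Inserting the next choice into a family of functions of the past. -/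
theorem eval {G : ℕ → Ω → E} (hG : ∀ j ≤ n, HistoryDetermined K n (G j)) :
    HistoryDetermined K (n + 1) fun ω => G (K n ω) ω := by
  intro ω ω' hω
  simp only
  rw [hω n (Nat.lt_succ_self n)]
  exact hG _ (Nat.lt_succ_iff.1 (K n ω').isLt) ω ω' fun i hi => hω i (by omega)

/-- `G` factors through the tuple of the first `n` choices, which lives in a finite discrete space.
-/
theorem stronglyMeasurable [TopologicalSpace E] [Nonempty E] (hG : HistoryDetermined K n G) :
    StronglyMeasurable[attachmentHistory K n] G := by
  let κ : Ω → ∀ i : Fin n, Fin (i + 1) := fun ω i => K i ω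
  have hf : Function.FactorsThrough G κ := fun ω ω' h =>
    hG ω ω' fun i hi => congrFun h ⟨i, hi⟩
  have hκ : Measurable[attachmentHistory K n] κ := by
    refine @measurable_pi_iff _ _ _ (attachmentHistory K n) _ _ |>.2 fun i => ?_
    exact (comap_measurable (K i)).mono
      (le_iSup₂_of_le (f := fun i (_ : i ∈ Set.Iio n) =>
        MeasurableSpace.comap (K i) inferInstance) (i : ℕ) i.isLt le_rfl) le_rfl
  have : G = Function.extend κ G (fun _ => Classical.arbitrary E) ∘ κ :=
    funext fun ω => (hf.extend_apply _ ω).symm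
  rw [this]
  exact StronglyMeasurable.of_discrete.comp_measurable hκ

theorem exists_norm_le [NormedAddCommGroup E] (hG : HistoryDetermined K n G) :
    ∃ C, ∀ ω, ‖G ω‖ ≤ C := by
  let κ : Ω → ∀ i : Fin n, Fin (i + 1) := fun ω i => K i ω
  have hf : Function.FactorsThrough (fun ω => ‖G ω‖) κ := fun ω ω' h =>
    congrArg norm (hG ω ω' fun i hi => congrFun h ⟨i, hi⟩)
  obtain ⟨C, hC⟩ := (Set.finite_range (Function.extend κ (fun ω => ‖G ω‖) 0)).bddAbove
  exact ⟨C, fun ω => hC ⟨κ ω, hf.extend_apply _ ω⟩⟩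

end HistoryDetermined

namespace IsUniformAttachment

variable {Ω E : Type*} [MeasurableSpace Ω] {μ : Measure Ω} [IsProbabilityMeasure μ]
  {K : ∀ i : ℕ, Ω → Fin (i + 1)}

/-- The filtration generated by the choices. -/
def filtration (hK : IsUniformAttachment μ K) : Filtration ℕ (inferInstance : MeasurableSpace Ω) where
  seq := attachmentHistory K
  mono' := fun _ _ h => biSup_mono fun _ hi => lt_of_lt_of_le hi h
  le' := fun _ => iSup₂_le fun i _ => (hK.measurable i).comap_le

theorem integrable [NormedAddCommGroup E] (hK : IsUniformAttachment μ K) {n : ℕ} {G : Ω → E}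
    (hG : HistoryDetermined K n G) : Integrable G μ := by
  obtain ⟨C, hC⟩ := hG.exists_norm_le
  exact Integrable.of_bound (hG.stronglyMeasurable.mono (hK.filtration.le n)).aestronglyMeasurable C
    (Eventually.of_forall hC)

variable [NormedAddCommGroup E] [NormedSpace ℝ E] [CompleteSpace E]

/-- Split according to the value of `K n`, which is independent of the history and uniform.
Measurability is assumed instead of `HistoryDetermined` so that indicators of arbitrary history
events are admitted. -/
theorem integral_eval_eq_of_stronglyMeasurable (hK : IsUniformAttachment μ K) (n : ℕ)
    {G : ℕ → Ω → E}
    (hm : ∀ j ≤ n, StronglyMeasurable[attachmentHistory K n] (G j))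
    (hi : ∀ j ≤ n, Integrable (G j) μ) :
    ∫ ω, G (K n ω) ω ∂μ = ((n : ℝ) + 1)⁻¹ • ∑ j ∈ Finset.range (n + 1), ∫ ω, G j ω ∂μ := by
  have hind : Indep (attachmentHistory K n) (MeasurableSpace.comap (K n) inferInstance) μ := by
    have := indep_iSup_of_disjoint (fun i => (hK.measurable i).comap_le)
      ((iIndepFun_iff_iIndep _ _ _).1 hK.indep)
      (show Disjoint (Set.Iio n) {n} by simp)
    simp only [Set.mem_singleton_iff, iSup_iSup_eq_left] at this
    exact this
  have hset : ∀ j : Fin (n + 1), MeasurableSet {ω | K n ω = j} := fun j =>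
    hK.measurable n (measurableSet_singleton j)
  have hone : ∀ j : Fin (n + 1),
      ∫ ω, Set.indicator {ω | K n ω = j} (G j) ω ∂μ = ((n : ℝ) + 1)⁻¹ • ∫ ω, G j ω ∂μ := by
    intro j
    have hj : (j : ℕ) ≤ n := Nat.lt_succ_iff.1 j.isLt
    rw [integral_indicator (hset j), ← setIntegral_condExp (hK.measurable n).comap_le (hi j hj)
      (s := {ω | K n ω = j}) ⟨{j}, measurableSet_singleton j, rfl⟩]
    rw [setIntegral_congr_ae (g := fun _ => ∫ ω, G j ω ∂μ) (hset j)
      ((condExp_indep_eq (hK.filtration.le n) (hK.measurable n).comap_le (hm j hj) hind).mono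
        fun ω h _ => h)]
    rw [setIntegral_const, measureReal_def, hK.uniform]
    congr 1
    rw [ENNReal.toReal_inv, ENNReal.toReal_add (by simp) (by simp)]
    simp
  have hsum : ∀ ω, G (K n ω) ω =
      ∑ j : Fin (n + 1), Set.indicator {ω | K n ω = j} (G j) ω := by
    intro ω
    rw [Finset.sum_eq_single (K n ω)]
    · simp
    · intro j _ hj
      exact Set.indicator_of_notMem (fun h => hj h.symm) _
    · simp
  rw [integral_congr_ae (Eventually.of_forall hsum), integral_finsetSum _ fun (j : Fin (n + 1)) _ =>
    (hi j (Nat.lt_succ_iff.1 j.isLt)).indicator (hset j), Finset.sum_range, Finset.smul_sum]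
  exact Finset.sum_congr rfl fun j _ => hone j

/-- The expectation over the parent of the vertex `n + 1` is an average over the vertices
`0, …, n`. -/
theorem integral_eval_eq (hK : IsUniformAttachment μ K) (n : ℕ) {G : ℕ → Ω → E}
    (hG : ∀ j ≤ n, HistoryDetermined K n (G j)) :
    ∫ ω, G (K n ω) ω ∂μ =
      ((n : ℝ) + 1)⁻¹ • ∫ ω, ∑ j ∈ Finset.range (n + 1), G j ω ∂μ := by
  have hle : ∀ j ∈ Finset.range (n + 1), j ≤ n := fun j hj =>
    Nat.lt_succ_iff.1 (Finset.mem_range.1 hj)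
  rw [hK.integral_eval_eq_of_stronglyMeasurable n (fun j hj => (hG j hj).stronglyMeasurable)
    (fun j hj => hK.integrable (hG j hj)),
    integral_finsetSum _ fun j hj => hK.integrable (hG j (hle j hj))]

end IsUniformAttachment

/-! ### The martingale of normalized path lengths -/

section PathLength

variable {Ω : Type*} (K : ∀ i : ℕ, Ω → Fin (i + 1))

/-- The depth of the vertex `v` in the random recursive tree. -/
def randomDepth (v : ℕ) (ω : Ω) : ℕ := vertexDepth (fun i => K i ω) v

/-- The depth of the parent of the vertex `n + 1`, minus the average depth of the vertices
`0, …, n`. -/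
noncomputable def depthDeviation (n : ℕ) (ω : Ω) : ℝ :=
  randomDepth K (K n ω) ω - rrtPathLength K n ω / ((n : ℝ) + 1)

theorem rrtPathLength_eq_sum (n : ℕ) (ω : Ω) :
    rrtPathLength K n ω = ∑ v ∈ Finset.range (n + 1), (randomDepth K v ω : ℝ) := by
  rw [rrtPathLength, totalPathLength_recursiveTree]
  push_cast
  rfl

theorem randomDepth_succ (n : ℕ) (ω : Ω) :
    randomDepth K (n + 1) ω = randomDepth K (K n ω) ω + 1 :=
  vertexDepth_succ _ n

theorem rrtPathLength_zero (ω : Ω) : rrtPathLength K 0 ω = 0 := by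
  simp [rrtPathLength_eq_sum, randomDepth, vertexDepth_zero]

theorem rrtPathLength_succ (n : ℕ) (ω : Ω) :
    rrtPathLength K (n + 1) ω = rrtPathLength K n ω + (randomDepth K (K n ω) ω + 1) := by
  rw [rrtPathLength_eq_sum, Finset.sum_range_succ, ← rrtPathLength_eq_sum, randomDepth_succ]
  push_cast
  rfl

theorem historyDetermined_randomDepth {n v : ℕ} (h : v ≤ n) :
    HistoryDetermined K n (randomDepth K v) :=
  fun _ _ hω => vertexDepth_congr fun i hi => hω i (hi.trans_le h)

theorem historyDetermined_rrtPathLength (n : ℕ) :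
    HistoryDetermined K n (rrtPathLength K n) := by
  intro ω ω' hω
  rw [rrtPathLength_eq_sum, rrtPathLength_eq_sum]
  refine Finset.sum_congr rfl fun v hv => ?_
  rw [historyDetermined_randomDepth K (Nat.lt_succ_iff.1 (Finset.mem_range.1 hv)) ω ω' hω]

theorem historyDetermined_depth_sub (n j : ℕ) (hj : j ≤ n) : HistoryDetermined K n
    fun ω => (randomDepth K j ω : ℝ) - rrtPathLength K n ω / ((n : ℝ) + 1) :=
  (historyDetermined_randomDepth K hj).comp₂ (historyDetermined_rrtPathLength K n)
    fun d r => (d : ℝ) - r / ((n : ℝ) + 1)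

theorem historyDetermined_depthDeviation (n : ℕ) :
    HistoryDetermined K (n + 1) (depthDeviation K n) :=
  HistoryDetermined.eval (historyDetermined_depth_sub K n)

theorem sum_depth_sub (n : ℕ) (ω : Ω) : ∑ j ∈ Finset.range (n + 1),
    ((randomDepth K j ω : ℝ) - rrtPathLength K n ω / ((n : ℝ) + 1)) = 0 := by
  have : (n : ℝ) + 1 ≠ 0 := by positivity
  rw [Finset.sum_sub_distrib, ← rrtPathLength_eq_sum, Finset.sum_const, Finset.card_range,
    nsmul_eq_mul]
  push_cast
  field_simp
  ring

end PathLength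

namespace IsUniformAttachment

variable {Ω : Type*} [MeasurableSpace Ω] {μ : Measure Ω}
  {K : ∀ i : ℕ, Ω → Fin (i + 1)}

theorem historyDetermined_normalizedPathLength (n : ℕ) :
    HistoryDetermined K n (normalizedPathLength μ K n) :=
  (historyDetermined_rrtPathLength K n).comp
    fun r => (r - ∫ ω', rrtPathLength K n ω' ∂μ) / ((n : ℝ) + 1)

variable [IsProbabilityMeasure μ]

theorem integral_rrtPathLength_succ (hK : IsUniformAttachment μ K) (n : ℕ) :
    ∫ ω, rrtPathLength K (n + 1) ω ∂μ =
      (∫ ω, rrtPathLength K n ω ∂μ) * ((n + 2) / (n + 1)) + 1 := by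
  have hi := hK.integrable (historyDetermined_rrtPathLength K n)
  have hG : ∀ j ≤ n, HistoryDetermined K n fun ω => (randomDepth K j ω : ℝ) + 1 := fun j hj =>
    (historyDetermined_randomDepth K hj).comp fun d => (d : ℝ) + 1
  have hev := hK.integral_eval_eq n hG
  have hadd : ∫ ω, rrtPathLength K (n + 1) ω ∂μ = ∫ ω, rrtPathLength K n ω ∂μ +
      ∫ ω, ((randomDepth K (K n ω) ω : ℝ) + 1) ∂μ := by
    rw [← integral_add hi (hK.integrable (HistoryDetermined.eval hG))]
    exact integral_congr_ae (Eventually.of_forall fun ω => rrtPathLength_succ K n ω)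
  have hsum : ∀ ω, ∑ j ∈ Finset.range (n + 1), ((randomDepth K j ω : ℝ) + 1) =
      rrtPathLength K n ω + (n + 1) := fun ω => by
    rw [Finset.sum_add_distrib, ← rrtPathLength_eq_sum]
    simp
  simp only [hsum] at hev
  rw [hadd, hev, integral_add hi (integrable_const _)]
  have : (n : ℝ) + 1 ≠ 0 := by positivity
  simp only [smul_eq_mul, integral_const, probReal_univ, one_mul]
  field_simp
  ring

theorem integral_rrtPathLength (hK : IsUniformAttachment μ K) (n : ℕ) :
    ∫ ω, rrtPathLength K n ω ∂μ = ((n : ℝ) + 1) * ((harmonic (n + 1) : ℝ) - 1) := by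
  induction n with
  | zero => simp [rrtPathLength_zero, harmonic_succ]
  | succ n ih =>
    rw [hK.integral_rrtPathLength_succ, ih, harmonic_succ (n + 1)]
    push_cast
    have : (n : ℝ) + 1 ≠ 0 := by positivity
    have : (n : ℝ) + 1 + 1 ≠ 0 := by positivity
    field_simp
    ring

/-- The factor `(n + 2) / (n + 1)` in the recursion for the mean is exactly the change of
normalization. -/
theorem normalizedPathLength_succ (hK : IsUniformAttachment μ K) (n : ℕ) (ω : Ω) :
    normalizedPathLength μ K (n + 1) ω =
      normalizedPathLength μ K n ω + depthDeviation K n ω / ((n : ℝ) + 2) := by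
  rw [normalizedPathLength, normalizedPathLength, hK.integral_rrtPathLength_succ,
    rrtPathLength_succ, depthDeviation]
  push_cast
  have : (n : ℝ) + 1 ≠ 0 := by positivity
  have : (n : ℝ) + 1 + 1 ≠ 0 := by positivity
  have : (n : ℝ) + 2 ≠ 0 := by positivity
  field_simp
  ring

/-- The deviation of the depth of the next parent from the average depth is orthogonal to the
past. -/
theorem integral_mul_depthDeviation (hK : IsUniformAttachment μ K) {n : ℕ} {H : Ω → ℝ}
    (hH : HistoryDetermined K n H) : ∫ ω, H ω * depthDeviation K n ω ∂μ = 0 := by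
  have := hK.integral_eval_eq n
    (G := fun j ω => H ω * ((randomDepth K j ω : ℝ) - rrtPathLength K n ω / ((n : ℝ) + 1)))
    fun j hj => hH.comp₂ (historyDetermined_depth_sub K n j hj) fun x y => x * y
  simp only [← Finset.mul_sum, sum_depth_sub, mul_zero, integral_zero, smul_zero] at this
  exact this

theorem setIntegral_depthDeviation (hK : IsUniformAttachment μ K) {n : ℕ} {s : Set Ω}
    (hs : MeasurableSet[attachmentHistory K n] s) : ∫ ω in s, depthDeviation K n ω ∂μ = 0 := by
  have hs' := hK.filtration.le n s hs
  have hi := fun j hj => hK.integrable (historyDetermined_depth_sub K n j hj)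
  have := hK.integral_eval_eq_of_stronglyMeasurable n
    (G := fun j => s.indicator fun ω =>
      (randomDepth K j ω : ℝ) - rrtPathLength K n ω / ((n : ℝ) + 1))
    (fun j hj => (historyDetermined_depth_sub K n j hj).stronglyMeasurable.indicator hs)
    (fun j hj => (hi j hj).indicator hs')
  rw [← integral_finsetSum _ fun j hj =>
    (hi j (Nat.lt_succ_iff.1 (Finset.mem_range.1 hj))).indicator hs'] at this
  have hz : ∀ ω, ∑ j ∈ Finset.range (n + 1), s.indicator (fun ω =>
      (randomDepth K j ω : ℝ) - rrtPathLength K n ω / ((n : ℝ) + 1)) ω = 0 := by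
    intro ω
    by_cases hω : ω ∈ s
    · simp only [Set.indicator_of_mem hω, sum_depth_sub]
    · simp only [Set.indicator_of_notMem hω, Finset.sum_const_zero]
  simp only [hz, integral_zero, smul_zero] at this
  rw [← integral_indicator hs', ← this]
  rfl

/-- The increments integrate to zero over history events, so this is in fact a martingale; the
weaker form is what the convergence theorem takes. -/
theorem submartingale_normalizedPathLength (hK : IsUniformAttachment μ K) :
    Submartingale (normalizedPathLength μ K) hK.filtration μ := by
  refine submartingale_of_setIntegral_le_succ
    (fun n => (historyDetermined_normalizedPathLength n).stronglyMeasurable)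
    (fun n => hK.integrable (historyDetermined_normalizedPathLength n)) fun n s hs => ?_
  have hi := hK.integrable (historyDetermined_normalizedPathLength (μ := μ) (K := K) n)
  have hd := hK.integrable (historyDetermined_depthDeviation K n)
  simp only [hK.normalizedPathLength_succ]
  rw [integral_add hi.integrableOn (hd.div_const _).integrableOn, integral_div,
    hK.setIntegral_depthDeviation hs]
  simp

/-! ### Moments -/

/-- A new vertex contributes twice the term of its parent, so the mean is multiplied by `1 + 2 / (n
+ 1) = (n + 3) / (n + 1)`. The average of `2 ^ depth` thus grows only linearly, which controls all
powers of the depth. -/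
theorem integral_sum_two_pow_depth (hK : IsUniformAttachment μ K) (n : ℕ) :
    ∫ ω, ∑ v ∈ Finset.range (n + 1), (2 : ℝ) ^ randomDepth K v ω ∂μ =
      ((n : ℝ) + 1) * (n + 2) / 2 := by
  have hH : ∀ n j : ℕ, j ≤ n → HistoryDetermined K n fun ω => (2 : ℝ) ^ randomDepth K j ω :=
    fun n j hj => (historyDetermined_randomDepth K hj).comp fun d => (2 : ℝ) ^ d
  induction n with
  | zero => simp [randomDepth, vertexDepth_zero]
  | succ n ih =>
    have hS : HistoryDetermined K n
        fun ω => ∑ v ∈ Finset.range (n + 1), (2 : ℝ) ^ randomDepth K v ω := by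
      intro ω ω' hω
      exact Finset.sum_congr rfl fun v hv =>
        hH n v (Nat.lt_succ_iff.1 (Finset.mem_range.1 hv)) ω ω' hω
    have hsplit : ∀ ω, ∑ v ∈ Finset.range (n + 1 + 1), (2 : ℝ) ^ randomDepth K v ω =
        (∑ v ∈ Finset.range (n + 1), (2 : ℝ) ^ randomDepth K v ω) +
          2 * (2 : ℝ) ^ randomDepth K (K n ω) ω := by
      intro ω
      rw [Finset.sum_range_succ, randomDepth_succ, pow_succ']
    simp only [hsplit]
    rw [integral_add (hK.integrable hS)
      ((hK.integrable (HistoryDetermined.eval (hH n))).const_mul _), integral_const_mul,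
      hK.integral_eval_eq n (hH n), ih, smul_eq_mul]
    push_cast
    have : (n : ℝ) + 1 ≠ 0 := by positivity
    field_simp
    ring

end IsUniformAttachment

/-! ### Elementary inequalities for the moment bounds -/

theorem exists_pow_le_mul_two_pow (N : ℕ) : ∃ C : ℝ, 0 ≤ C ∧ ∀ d : ℕ, (d : ℝ) ^ N ≤ C * 2 ^ d := by
  obtain ⟨C, hC⟩ := (tendsto_pow_const_div_const_pow_of_one_lt N
    (one_lt_two : (1 : ℝ) < 2)).bddAbove_range
  have hC' : ∀ d : ℕ, (d : ℝ) ^ N ≤ C * 2 ^ d := fun d =>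
    (div_le_iff₀ (by positivity)).1 (hC ⟨d, rfl⟩)
  refine ⟨C, ?_, hC'⟩
  have := hC' 0
  rw [pow_zero, mul_one] at this
  exact le_trans (by positivity) this

/-- For nonnegative numbers the distance to the mean is at most the larger of the two, and by Jensen
the power of the mean is at most the mean of the powers. -/
theorem sum_sub_average_pow_le {ι : Type*} {s : Finset ι} {d : ι → ℝ} (hd : ∀ i ∈ s, 0 ≤ d i)
    {N : ℕ} (hN : Even N) (hN0 : N ≠ 0) :
    ∑ i ∈ s, (d i - (∑ j ∈ s, d j) / s.card) ^ N ≤ 2 * ∑ i ∈ s, d i ^ N := by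
  rcases s.eq_empty_or_nonempty with rfl | hs
  · simp
  have hcard : (0 : ℝ) < s.card := by exact_mod_cast hs.card_pos
  set a := (∑ j ∈ s, d j) / s.card with ha
  have ha0 : 0 ≤ a := div_nonneg (Finset.sum_nonneg hd) hcard.le
  have hone : ∀ i ∈ s, (d i - a) ^ N ≤ d i ^ N + a ^ N := by
    intro i hi
    rw [← hN.pow_abs]
    have h0 := hd i hi
    rcases le_total a (d i) with h | h
    · calc |d i - a| ^ N ≤ d i ^ N := by
            rw [abs_of_nonneg (by linarith)]
            exact pow_le_pow_left₀ (by linarith) (by linarith) N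
        _ ≤ _ := le_add_of_nonneg_right (by positivity)
    · calc |d i - a| ^ N ≤ a ^ N := by
            rw [abs_of_nonpos (by linarith)]
            exact pow_le_pow_left₀ (by linarith) (by linarith) N
        _ ≤ _ := le_add_of_nonneg_left (by positivity)
  obtain ⟨M, rfl⟩ := Nat.exists_eq_succ_of_ne_zero hN0
  have hmean := pow_sum_div_card_le_sum_pow hd M
  have haM : (s.card : ℝ) * a ^ (M + 1) = (∑ j ∈ s, d j) ^ (M + 1) / (s.card : ℝ) ^ M := by
    rw [ha, div_pow]
    field_simp
    ring
  calc _ ≤ ∑ i ∈ s, (d i ^ (M + 1) + a ^ (M + 1)) := Finset.sum_le_sum hone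
    _ = ∑ i ∈ s, d i ^ (M + 1) + (s.card : ℝ) * a ^ (M + 1) := by
      rw [Finset.sum_add_distrib, Finset.sum_const, nsmul_eq_mul]
    _ ≤ _ := by rw [haM]; linarith

/-- A second order expansion of an even power. -/
theorem add_mul_pow_le {N : ℕ} (hN : Even N) (hN2 : 2 ≤ N) {z e ε : ℝ} (hε : 0 ≤ ε)
    (hε1 : ε ≤ 1) :
    (z + ε * e) ^ N ≤ z ^ N + N * z ^ (N - 1) * (ε * e) + 2 ^ N * ε ^ 2 * (z ^ N + e ^ N) := by
  obtain ⟨M, rfl⟩ := Nat.exists_eq_add_of_le hN2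
  rw [add_comm 2 M] at *
  have hmax : ∀ m ≤ M + 2, |z| ^ m * |e| ^ (M + 2 - m) ≤ z ^ (M + 2) + e ^ (M + 2) := by
    intro m hm
    rw [← hN.pow_abs z, ← hN.pow_abs e]
    rcases le_total |z| |e| with h | h
    · calc |z| ^ m * |e| ^ (M + 2 - m) ≤ |e| ^ m * |e| ^ (M + 2 - m) := by gcongr
        _ = |e| ^ (M + 2) := by rw [← pow_add]; congr 1; omega
        _ ≤ _ := le_add_of_nonneg_left (by positivity)
    · calc |z| ^ m * |e| ^ (M + 2 - m) ≤ |z| ^ m * |z| ^ (M + 2 - m) := by gcongr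
        _ = |z| ^ (M + 2) := by rw [← pow_add]; congr 1; omega
        _ ≤ _ := le_add_of_nonneg_right (by positivity)
  have hS : 0 ≤ z ^ (M + 2) + e ^ (M + 2) := add_nonneg (hN.pow_nonneg z) (hN.pow_nonneg e)
  -- Beyond first order each binomial term carries at least `ε ^ 2`, and its monomial is at most the
  -- sum of the two top powers.
  have hterm : ∀ m ∈ Finset.range (M + 1), z ^ m * (ε * e) ^ (M + 2 - m) * ((M + 2).choose m) ≤
      ((M + 2).choose m) * (ε ^ 2 * (z ^ (M + 2) + e ^ (M + 2))) := by
    intro m hm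
    have hm' := Finset.mem_range.1 hm
    rw [mul_comm]
    refine mul_le_mul_of_nonneg_left ?_ (by positivity)
    calc z ^ m * (ε * e) ^ (M + 2 - m) ≤ |z ^ m * (ε * e) ^ (M + 2 - m)| := le_abs_self _
      _ = ε ^ (M + 2 - m) * (|z| ^ m * |e| ^ (M + 2 - m)) := by
        rw [abs_mul, abs_pow, abs_pow, abs_mul, abs_of_nonneg hε, mul_pow]
        ring
      _ ≤ ε ^ 2 * (z ^ (M + 2) + e ^ (M + 2)) := by
        gcongr ?_ * ?_
        · exact pow_le_pow_of_le_one hε hε1 (by omega)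
        · exact hmax m (by omega)
  have hchoose : ∑ m ∈ Finset.range (M + 1), ((M + 2).choose m : ℝ) ≤ 2 ^ (M + 2) := by
    have h1 := Nat.sum_range_choose (M + 2)
    have h2 : ∑ m ∈ Finset.range (M + 1), (M + 2).choose m ≤ 2 ^ (M + 2) := by
      rw [← h1]
      exact Finset.sum_le_sum_of_subset (Finset.range_subset_range.2 (by omega))
    exact_mod_cast h2
  have hrest : ∑ m ∈ Finset.range (M + 1), z ^ m * (ε * e) ^ (M + 2 - m) * ((M + 2).choose m) ≤
      2 ^ (M + 2) * (ε ^ 2 * (z ^ (M + 2) + e ^ (M + 2))) := by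
    refine (Finset.sum_le_sum hterm).trans ?_
    rw [← Finset.sum_mul]
    exact mul_le_mul_of_nonneg_right hchoose (by positivity)
  rw [add_pow, Finset.sum_range_succ, Finset.sum_range_succ,
    show M + 2 - (M + 1) = 1 by omega, show M + 2 - 1 = M + 1 by omega, Nat.sub_self,
    Nat.choose_self, show (M + 2).choose (M + 1) = M + 2 from Nat.choose_succ_self_right (M + 1)]
  push_cast at hrest ⊢
  linarith

/-- Discrete Grönwall inequality, from `1 + x ≤ exp x` applied to `b n + C`. -/
theorem bddAbove_range_of_le_one_add_mul {b r : ℕ → ℝ} {c C : ℝ} (hr : ∀ n, 0 ≤ r n)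
    (hsum : Summable r) (hb : ∀ n, 0 ≤ b n) (hc : 0 ≤ c) (hC : 0 ≤ C)
    (h : ∀ n, b (n + 1) ≤ b n + c * r n * (b n + C)) : ∃ B, ∀ n, b n ≤ B := by
  have key : ∀ n, b n + C ≤ Real.exp (c * ∑ i ∈ Finset.range n, r i) * (b 0 + C) := by
    intro n
    induction n with
    | zero => simp
    | succ n ih =>
      rw [Finset.sum_range_succ, mul_add c, add_comm (c * _), Real.exp_add, mul_assoc]
      calc b (n + 1) + C ≤ (c * r n + 1) * (b n + C) := by linarith [h n]
        _ ≤ Real.exp (c * r n) * (b n + C) :=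
          mul_le_mul_of_nonneg_right (Real.add_one_le_exp _) (add_nonneg (hb n) hC)
        _ ≤ _ := mul_le_mul_of_nonneg_left ih (Real.exp_pos _).le
  refine ⟨Real.exp (c * ∑' i, r i) * (b 0 + C), fun n => ?_⟩
  have h0 : 0 ≤ b 0 + C := add_nonneg (hb 0) hC
  calc b n ≤ b n + C := by linarith
    _ ≤ _ := key n
    _ ≤ _ := by
      gcongr
      exact hsum.sum_le_tsum _ fun i _ => hr i

/-! ### Uniform integrability -/

section Lp

variable {Ω : Type*} [MeasurableSpace Ω] {μ : Measure Ω}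

/-- Boundedness in `L^q` for all large `q` gives uniform integrability in `L^p`. -/
theorem unifIntegrable_of_eLpNorm_le {f : ℕ → Ω → ℝ} {p q R : ℝ≥0∞} (hp : 1 ≤ p) (hpq : p < q)
    (hq : q ≠ ∞) (hR : R ≠ ∞) (hf : ∀ n, AEStronglyMeasurable (f n) μ)
    (hb : ∀ n, eLpNorm (f n) q μ ≤ R) : UnifIntegrable f p μ := by
  have hp' : p ≠ ∞ := (hpq.trans_le le_top).ne
  have hp0 : 0 < p.toReal := ENNReal.toReal_pos (zero_lt_one.trans_le hp).ne' hp'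
  have hlt : p.toReal < q.toReal := (ENNReal.toReal_lt_toReal hp' hq).2 hpq
  -- The exponent of `μ s` when Hölder's inequality compares the `L^p` and `L^q` norms on a set `s`.
  set a := 1 / p.toReal - 1 / q.toReal with ha
  have ha0 : 0 < a := sub_pos.2 (one_div_lt_one_div_of_lt hp0 hlt)
  intro ε hε
  have hlim : Tendsto (fun x : ℝ≥0∞ => R * x ^ a) (𝓝 0) (𝓝 0) := by
    have h1 : Tendsto (fun x : ℝ≥0∞ => x ^ a) (𝓝 0) (𝓝 0) := by
      have := (ENNReal.continuous_rpow_const (y := a)).tendsto 0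
      rwa [ENNReal.zero_rpow_of_pos ha0] at this
    have := ENNReal.Tendsto.const_mul h1 (Or.inr hR)
    rwa [mul_zero] at this
  have hev := hlim.eventually (gt_mem_nhds (ENNReal.ofReal_pos.2 hε))
  obtain ⟨δ, hδ, hδ'⟩ := ENNReal.nhds_zero_basis_Iic.mem_iff.1 hev
  have hmin : 0 < min δ 1 := lt_min hδ zero_lt_one
  have hmin' : min δ 1 ≠ ∞ := ne_top_of_le_ne_top ENNReal.one_ne_top (min_le_right _ _)
  refine ⟨(min δ 1).toReal, ENNReal.toReal_pos hmin.ne' hmin', fun n s hs hμs => ?_⟩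
  rw [ENNReal.ofReal_toReal hmin'] at hμs
  rw [eLpNorm_indicator_eq_eLpNorm_restrict hs]
  refine (eLpNorm_le_eLpNorm_mul_rpow_measure_univ hpq.le (hf n).restrict).trans ?_
  rw [Measure.restrict_apply_univ, ← ha]
  calc _ ≤ R * μ s ^ a :=
        mul_le_mul_left ((eLpNorm_mono_measure _ Measure.restrict_le_self).trans (hb n)) _
    _ ≤ _ := (hδ' (hμs.trans (min_le_left _ _))).le

end Lp

/-! ### Bounded moments and convergence -/

namespace IsUniformAttachment

variable {Ω : Type*} [MeasurableSpace Ω] {μ : Measure Ω} [IsProbabilityMeasure μ]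
  {K : ∀ i : ℕ, Ω → Fin (i + 1)}

/-- Crude linear growth suffices, since the increments carry a factor `1 / (n + 2)`. It comes from
bounding powers of the depth by multiples of `2 ^ depth`. -/
theorem exists_integral_depthDeviation_pow_le (hK : IsUniformAttachment μ K) {N : ℕ}
    (hN : Even N) (hN0 : N ≠ 0) :
    ∃ C : ℝ, 0 ≤ C ∧ ∀ n : ℕ, ∫ ω, depthDeviation K n ω ^ N ∂μ ≤ C * (n + 2) := by
  obtain ⟨C, hC0, hC⟩ := exists_pow_le_mul_two_pow N
  refine ⟨C, hC0, fun n => ?_⟩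
  have hD := historyDetermined_depth_sub K n
  have hev := hK.integral_eval_eq n (G := fun j ω =>
    ((randomDepth K j ω : ℝ) - rrtPathLength K n ω / ((n : ℝ) + 1)) ^ N)
    fun j hj => (hD j hj).comp fun x => x ^ N
  have hS : HistoryDetermined K n fun ω => ∑ j ∈ Finset.range (n + 1),
      ((randomDepth K j ω : ℝ) - rrtPathLength K n ω / ((n : ℝ) + 1)) ^ N := fun ω ω' hω =>
    Finset.sum_congr rfl fun j hj => congrArg (· ^ N)
      (hD j (Nat.lt_succ_iff.1 (Finset.mem_range.1 hj)) ω ω' hω)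
  have hT : HistoryDetermined K n fun ω => ∑ j ∈ Finset.range (n + 1),
      (2 : ℝ) ^ randomDepth K j ω := fun ω ω' hω =>
    Finset.sum_congr rfl fun j hj => congrArg (fun d : ℕ => (2 : ℝ) ^ d)
      (historyDetermined_randomDepth K (Nat.lt_succ_iff.1 (Finset.mem_range.1 hj)) ω ω' hω)
  have hle : ∫ ω, ∑ j ∈ Finset.range (n + 1),
      ((randomDepth K j ω : ℝ) - rrtPathLength K n ω / ((n : ℝ) + 1)) ^ N ∂μ ≤
      ∫ ω, 2 * C * ∑ j ∈ Finset.range (n + 1), (2 : ℝ) ^ randomDepth K j ω ∂μ := by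
    refine integral_mono (hK.integrable hS) ((hK.integrable hT).const_mul _) fun ω => ?_
    have h1 := sum_sub_average_pow_le (s := Finset.range (n + 1))
      (d := fun j => (randomDepth K j ω : ℝ)) (fun _ _ => by positivity) hN hN0
    rw [← rrtPathLength_eq_sum, Finset.card_range] at h1
    push_cast at h1
    refine h1.trans ?_
    rw [mul_assoc, Finset.mul_sum _ _ C]
    gcongr with j
    exact hC _
  rw [integral_const_mul, hK.integral_sum_two_pow_depth] at hle
  have hn : (0 : ℝ) < (n : ℝ) + 1 := by positivity
  calc _ = ((n : ℝ) + 1)⁻¹ • _ := hev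
    _ ≤ ((n : ℝ) + 1)⁻¹ • (2 * C * (((n : ℝ) + 1) * (n + 2) / 2)) := by
        rw [smul_eq_mul, smul_eq_mul]; gcongr
    _ = _ := by rw [smul_eq_mul]; field_simp

/-- The even moments of the normalized path lengths are bounded. -/
theorem exists_integral_normalizedPathLength_pow_le (hK : IsUniformAttachment μ K) {N : ℕ}
    (hN : Even N) (hN4 : 4 ≤ N) :
    ∃ B : ℝ, ∀ n : ℕ, ∫ ω, normalizedPathLength μ K n ω ^ N ∂μ ≤ B := by
  obtain ⟨C, hC0, hC⟩ := hK.exists_integral_depthDeviation_pow_le hN (by omega)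
  have hsum : Summable fun n : ℕ => ((n : ℝ) + 2) ^ (-(3 / 2) : ℝ) := by
    have := (Real.summable_one_div_nat_add_rpow 2 (3 / 2)).2 (by norm_num)
    refine this.congr fun n => ?_
    have hn : (0 : ℝ) < (n : ℝ) + 2 := by positivity
    rw [abs_of_pos hn, Real.rpow_neg hn.le, one_div]
  refine bddAbove_range_of_le_one_add_mul (c := 2 ^ N) (C := C)
    (fun n => Real.rpow_nonneg (by positivity) _) hsum
    (fun n => integral_nonneg fun ω => hN.pow_nonneg _) (by positivity) hC0 fun n => ?_
  have hn : (0 : ℝ) < (n : ℝ) + 2 := by positivity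
  -- The factor `1 / (n + 2)` is split as `q⁻³ q⁻¹`. Dividing the deviation by `q` makes its `N`-th
  -- moment bounded, because `q ^ N ≥ n + 2` for `N ≥ 4`. The remaining `ε = q⁻³` has the summable
  -- square `(n + 2) ^ (-3/2)`.
  set q : ℝ := ((n : ℝ) + 2) ^ (1 / 4 : ℝ) with hq
  have hq1 : 1 ≤ q := Real.one_le_rpow (by linarith [(n.cast_nonneg : (0 : ℝ) ≤ n)]) (by norm_num)
  have hq0 : 0 < q := by linarith
  have hq4 : q ^ 4 = (n : ℝ) + 2 := by
    rw [hq, ← Real.rpow_natCast, ← Real.rpow_mul hn.le]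
    norm_num
  have hq6 : ((q ^ 3)⁻¹) ^ 2 = ((n : ℝ) + 2) ^ (-(3 / 2) : ℝ) := by
    rw [Real.rpow_neg hn.le, inv_pow, ← pow_mul, hq, ← Real.rpow_natCast, ← Real.rpow_mul hn.le]
    norm_num
  set ε : ℝ := (q ^ 3)⁻¹ with hε
  have hε0 : 0 ≤ ε := by positivity
  have hε1 : ε ≤ 1 := inv_le_one_of_one_le₀ (one_le_pow₀ hq1)
  have hz := historyDetermined_normalizedPathLength (μ := μ) (K := K) n
  have hd := historyDetermined_depthDeviation K n
  have hze := (hz.comp fun x => x ^ (N - 1))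
  have hI1 := hK.integrable (hz.comp fun x => x ^ N)
  have hI2 : Integrable (fun ω => normalizedPathLength μ K n ω ^ (N - 1) * depthDeviation K n ω) μ :=
    hK.integrable ((hze.mono n.le_succ).comp₂ hd fun x y => x * y)
  have hI3 : Integrable (fun ω => (depthDeviation K n ω / q) ^ N) μ :=
    hK.integrable (hd.comp fun x => (x / q) ^ N)
  have hpt : ∀ ω, normalizedPathLength μ K (n + 1) ω ^ N ≤
      normalizedPathLength μ K n ω ^ N +
      N * ((n : ℝ) + 2)⁻¹ * (normalizedPathLength μ K n ω ^ (N - 1) * depthDeviation K n ω) +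
      2 ^ N * ε ^ 2 * (normalizedPathLength μ K n ω ^ N + (depthDeviation K n ω / q) ^ N) := by
    intro ω
    have hdiv : depthDeviation K n ω / ((n : ℝ) + 2) = ε * (depthDeviation K n ω / q) := by
      rw [← hq4, hε]
      field_simp
    rw [hK.normalizedPathLength_succ, hdiv]
    refine (add_mul_pow_le hN (by omega) hε0 hε1).trans (le_of_eq ?_)
    rw [← hdiv]
    ring
  have hI4 : Integrable (fun ω => normalizedPathLength μ K n ω ^ N + N * ((n : ℝ) + 2)⁻¹ *
      (normalizedPathLength μ K n ω ^ (N - 1) * depthDeviation K n ω)) μ :=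
    hI1.add (hI2.const_mul _)
  have hI5 : Integrable (fun ω => 2 ^ N * ε ^ 2 *
      (normalizedPathLength μ K n ω ^ N + (depthDeviation K n ω / q) ^ N)) μ :=
    (hI1.add hI3).const_mul _
  have hint := integral_mono (hK.integrable ((historyDetermined_normalizedPathLength (μ := μ)
    (K := K) (n + 1)).comp fun x => x ^ N))
    (hI4.add hI5) hpt
  rw [integral_add' hI4 hI5, integral_add hI1 (hI2.const_mul _), integral_const_mul, integral_const_mul,
    integral_add hI1 hI3, hK.integral_mul_depthDeviation hze, mul_zero, add_zero] at hint
  have he : ∫ ω, (depthDeviation K n ω / q) ^ N ∂μ ≤ C := by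
    simp only [div_pow]
    rw [integral_div, div_le_iff₀ (by positivity)]
    refine (hC n).trans (mul_le_mul_of_nonneg_left ?_ hC0)
    rw [← hq4]
    exact pow_le_pow_right₀ hq1 hN4
  rw [hq6] at hint
  refine hint.trans ?_
  gcongr

theorem exists_eLpNorm_normalizedPathLength_le (hK : IsUniformAttachment μ K) {p : ℝ≥0∞}
    (hp : p ≠ ∞) : ∃ R : NNReal, ∀ n, eLpNorm (normalizedPathLength μ K n) p μ ≤ R := by
  obtain ⟨M, hM⟩ := ENNReal.exists_nat_gt hp
  set N := 2 * (M + 2) with hN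
  obtain ⟨B, hB⟩ := hK.exists_integral_normalizedPathLength_pow_le (N := N)
    (even_two_mul _) (by omega)
  have hN0 : (N : ℝ≥0∞) ≠ 0 := by simp [hN]
  have hpN : p ≤ N := by
    refine hM.le.trans ?_
    exact_mod_cast (by omega : M ≤ N)
  refine ⟨(B ^ (N : ℝ)⁻¹).toNNReal, fun n => ?_⟩
  have hz := historyDetermined_normalizedPathLength (μ := μ) (K := K) n
  have hm := (hz.stronglyMeasurable.mono (hK.filtration.le n)).aestronglyMeasurable (μ := μ)
  obtain ⟨c, hc⟩ := hz.exists_norm_le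
  have hmem : MemLp (normalizedPathLength μ K n) N μ :=
    MemLp.of_bound hm c (Eventually.of_forall hc)
  refine (eLpNorm_le_eLpNorm_of_exponent_le hpN hm).trans ?_
  rw [hmem.eLpNorm_eq_integral_rpow_norm hN0 (ENNReal.natCast_ne_top N)]
  refine ENNReal.ofReal_le_ofReal ?_
  simp only [ENNReal.toReal_natCast, Real.rpow_natCast, Real.norm_eq_abs, (even_two_mul _).pow_abs,
    hN]
  rw [← hN]
  exact Real.rpow_le_rpow (integral_nonneg fun ω => (even_two_mul _).pow_nonneg _) (hB n)
    (by positivity)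

theorem exists_limit (hK : IsUniformAttachment μ K) :
    ∃ X : Ω → ℝ, Measurable X ∧
      (∀ᵐ ω ∂μ, Tendsto (fun n => normalizedPathLength μ K n ω) atTop (𝓝 (X ω))) ∧
      ∀ p : ℝ≥0∞, 0 < p → p ≠ ∞ → MemLp X p μ ∧
        Tendsto (fun n => eLpNorm (fun ω => normalizedPathLength μ K n ω - X ω) p μ)
          atTop (𝓝 0) := by
  have hsub := hK.submartingale_normalizedPathLength
  have hm : ∀ n, AEStronglyMeasurable (normalizedPathLength μ K n) μ := fun n =>
    ((hsub.stronglyMeasurable n).mono (hK.filtration.le n)).aestronglyMeasurable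
  obtain ⟨R, hR⟩ := hK.exists_eLpNorm_normalizedPathLength_le ENNReal.one_ne_top
  have hlim := hsub.ae_tendsto_limitProcess hR
  have hmeas : StronglyMeasurable (hK.filtration.limitProcess (normalizedPathLength μ K) μ) :=
    Filtration.stronglyMeasurable_limit_process'
  refine ⟨_, hmeas.measurable, hlim, fun p _ hp => ?_⟩
  have hmem : ∀ q : ℝ≥0∞, q ≠ ∞ →
      MemLp (hK.filtration.limitProcess (normalizedPathLength μ K) μ) q μ := fun q hq => by
    obtain ⟨R, hR⟩ := hK.exists_eLpNorm_normalizedPathLength_le hq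
    exact hsub.memLp_limitProcess hR
  refine ⟨hmem p hp, ?_⟩
  -- Vitali's theorem needs an exponent of at least `1`, and boundedness at one more gives the
  -- uniform integrability. Smaller `p` follow since `μ` is a probability measure.
  have hr1 : 1 ≤ max p 1 := le_max_right _ _
  have hr : max p 1 ≠ ∞ := (max_lt hp.lt_top ENNReal.one_lt_top).ne
  have hr2 : max p 1 + 1 ≠ ∞ := ENNReal.add_ne_top.2 ⟨hr, ENNReal.one_ne_top⟩
  obtain ⟨R', hR'⟩ := hK.exists_eLpNorm_normalizedPathLength_le hr2
  have hui := unifIntegrable_of_eLpNorm_le hr1 (ENNReal.lt_add_right hr one_ne_zero) hr2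
    ENNReal.coe_ne_top hm hR'
  have hconv := tendsto_Lp_finite_of_tendsto_ae hr1 hr hm (hmem _ hr) hui hlim
  refine tendsto_of_tendsto_of_tendsto_of_le_of_le tendsto_const_nhds hconv
    (fun _ => zero_le) fun n => ?_
  exact eLpNorm_le_eLpNorm_of_exponent_le (le_max_left _ _)
    ((hm n).sub hmeas.aestronglyMeasurable)

end IsUniformAttachment

/-! ### The splitting recursion -/

/-- The sum of `z` to the total depth over all ways of attaching `n` vertices, one after the other,
to a forest with vertices of the depths `s`. -/
def attachmentSum (z : ℂ) : ℕ → Multiset ℕ → ℂ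
  | 0, s => z ^ s.sum
  | n + 1, s => (s.map fun d => attachmentSum z n ((d + 1) ::ₘ s)).sum

/-- Two parts of a forest grow without interaction; the binomial coefficient counts the
interleavings of their attachments. -/
theorem attachmentSum_add (z : ℂ) (n : ℕ) (s t : Multiset ℕ) :
    attachmentSum z n (s + t) = ∑ ij ∈ Finset.HasAntidiagonal.antidiagonal n,
      (n.choose ij.1 : ℂ) * (attachmentSum z ij.1 s * attachmentSum z ij.2 t) := by
  induction n generalizing s t with
  | zero => simp [attachmentSum, pow_add]
  | succ n ih =>
    have hl : ∀ d, attachmentSum z n ((d + 1) ::ₘ (s + t)) = ∑ ij ∈ Finset.HasAntidiagonal.antidiagonal n,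
        (n.choose ij.1 : ℂ) * (attachmentSum z ij.1 ((d + 1) ::ₘ s) * attachmentSum z ij.2 t) :=
      fun d => by rw [← Multiset.cons_add, ih]
    have hr : ∀ d, attachmentSum z n ((d + 1) ::ₘ (s + t)) = ∑ ij ∈ Finset.HasAntidiagonal.antidiagonal n,
        (n.choose ij.1 : ℂ) * (attachmentSum z ij.1 s * attachmentSum z ij.2 ((d + 1) ::ₘ t)) :=
      fun d => by rw [← Multiset.add_cons, ih]
    rw [Finset.sum_antidiagonal_choose_succ_mul
      (fun i j => attachmentSum z i s * attachmentSum z j t), attachmentSum, Multiset.map_add,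
      Multiset.sum_add, add_comm]
    congr 1
    · rw [Multiset.map_congr rfl fun d _ => hr d, Multiset.sum_map_sum]
      refine Finset.sum_congr rfl fun ij _ => ?_
      rw [Multiset.sum_map_mul_left, Multiset.sum_map_mul_left, attachmentSum]
    · rw [Multiset.map_congr rfl fun d _ => hl d, Multiset.sum_map_sum]
      refine Finset.sum_congr rfl fun ij hij => ?_
      rw [Multiset.sum_map_mul_left, Multiset.sum_map_mul_right, attachmentSum,
        Nat.choose_symm_of_eq_add (Finset.HasAntidiagonal.mem_antidiagonal.1 hij).symm]

/-- Lowering the forest by one level adds one for each of the final `s.card + n` vertices. -/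
theorem attachmentSum_map_succ (z : ℂ) (n : ℕ) (s : Multiset ℕ) :
    attachmentSum z n (s.map (· + 1)) = z ^ (s.card + n) * attachmentSum z n s := by
  induction n generalizing s with
  | zero => simp [attachmentSum, Multiset.sum_map_add, pow_add, mul_comm]
  | succ n ih =>
    rw [attachmentSum, attachmentSum, Multiset.map_map, ← Multiset.sum_map_mul_left]
    refine congrArg Multiset.sum (Multiset.map_congr rfl fun d _ => ?_)
    have := ih ((d + 1) ::ₘ s)
    rw [Multiset.map_cons, Multiset.card_cons] at this
    rw [Function.comp_apply, this]
    congr 2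
    omega

/-- The first attachment is forced. Afterwards the descendants of the new vertex, one level down,
and the rest of the tree grow as two separate parts. -/
theorem attachmentSum_succ_singleton (z : ℂ) (n : ℕ) :
    attachmentSum z (n + 1) {0} = ∑ ij ∈ Finset.HasAntidiagonal.antidiagonal n, (n.choose ij.1 : ℂ) *
      (z ^ (ij.1 + 1) * attachmentSum z ij.1 {0} * attachmentSum z ij.2 {0}) := by
  have h1 : ∀ i, attachmentSum z i {1} = z ^ (i + 1) * attachmentSum z i {0} := fun i => by
    have := attachmentSum_map_succ z i {0}
    rw [Multiset.map_singleton, Multiset.card_singleton, add_comm 1 i] at this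
    exact this
  have h2 : attachmentSum z (n + 1) {0} = attachmentSum z n ({1} + {0}) := by
    rw [attachmentSum, Multiset.map_singleton, Multiset.sum_singleton, Multiset.singleton_add]
  rw [h2, attachmentSum_add]
  simp only [h1]

/-- The multiset of the depths of the vertices of the random recursive tree. -/
def depthMultiset {Ω : Type*} (K : ∀ i : ℕ, Ω → Fin (i + 1)) (n : ℕ) (ω : Ω) : Multiset ℕ :=
  (Multiset.range (n + 1)).map fun v => randomDepth K v ω

theorem sum_depthMultiset {Ω : Type*} (K : ∀ i : ℕ, Ω → Fin (i + 1)) (n : ℕ) (ω : Ω) :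
    ((depthMultiset K n ω).sum : ℝ) = rrtPathLength K n ω := by
  rw [rrtPathLength_eq_sum, depthMultiset, ← Finset.range_val]
  exact_mod_cast rfl

theorem historyDetermined_depthMultiset {Ω : Type*} (K : ∀ i : ℕ, Ω → Fin (i + 1)) (n : ℕ) :
    HistoryDetermined K n (depthMultiset K n) := fun ω ω' hω =>
  Multiset.map_congr rfl fun _ hv => historyDetermined_randomDepth K
    (Nat.lt_succ_iff.1 (Multiset.mem_range.1 hv)) ω ω' hω

namespace IsUniformAttachment

variable {Ω : Type*} [MeasurableSpace Ω] {μ : Measure Ω} [IsProbabilityMeasure μ]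
  {K : ∀ i : ℕ, Ω → Fin (i + 1)}

theorem integral_attachmentSum_succ (hK : IsUniformAttachment μ K) (z : ℂ) (m n : ℕ) :
    ∫ ω, attachmentSum z (m + 1) (depthMultiset K n ω) ∂μ =
      ((n : ℂ) + 1) * ∫ ω, attachmentSum z m (depthMultiset K (n + 1) ω) ∂μ := by
  have hev := hK.integral_eval_eq n (G := fun j ω =>
      attachmentSum z m ((randomDepth K j ω + 1) ::ₘ depthMultiset K n ω)) fun j hj =>
    (historyDetermined_randomDepth K hj).comp₂ (historyDetermined_depthMultiset K n)
      fun d s => attachmentSum z m ((d + 1) ::ₘ s)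
  have hcons : ∀ ω, depthMultiset K (n + 1) ω =
      (randomDepth K (K n ω) ω + 1) ::ₘ depthMultiset K n ω := by
    intro ω
    rw [depthMultiset, Multiset.range_succ, Multiset.map_cons, randomDepth_succ, depthMultiset]
  have hsum : ∀ ω, ∑ j ∈ Finset.range (n + 1),
      attachmentSum z m ((randomDepth K j ω + 1) ::ₘ depthMultiset K n ω) =
      attachmentSum z (m + 1) (depthMultiset K n ω) := by
    intro ω
    rw [attachmentSum, Finset.sum, Finset.range_val]
    nth_rewrite 3 [depthMultiset]
    rw [Multiset.map_map]
    rfl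
  simp only [hsum, ← hcons] at hev
  have : (n : ℂ) + 1 ≠ 0 := by exact_mod_cast n.succ_ne_zero
  rw [hev, Complex.real_smul]
  push_cast
  field_simp

/-- Random steps are traded one by one for enumerated ones, each at the cost of the number of
possible parents. At `m = 0` the counting recursion becomes one for the random tree. -/
theorem integral_attachmentSum (hK : IsUniformAttachment μ K) (z : ℂ) (m n : ℕ) :
    (n.factorial : ℂ) * ∫ ω, attachmentSum z m (depthMultiset K n ω) ∂μ =
      attachmentSum z (m + n) {0} := by
  induction n generalizing m with
  | zero =>
    have : ∀ ω, depthMultiset K 0 ω = {0} := fun ω => by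
      simp [depthMultiset, randomDepth, vertexDepth_zero]
    simp [this]
  | succ n ih =>
    have := ih (m + 1)
    rw [hK.integral_attachmentSum_succ] at this
    rw [show m + (n + 1) = m + 1 + n by omega, ← this, Nat.factorial_succ]
    push_cast
    ring

/-- The splitting recursion for the generating functions of the path lengths, which reflects that
the size of the subtree of the vertex `1` is uniformly distributed. -/
theorem integral_pow_sum_depthMultiset_succ (hK : IsUniformAttachment μ K) (z : ℂ) (n : ℕ) :
    ∫ ω, z ^ (depthMultiset K (n + 1) ω).sum ∂μ = ((n : ℂ) + 1)⁻¹ *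
      ∑ j ∈ Finset.range (n + 1), z ^ (j + 1) * (∫ ω, z ^ (depthMultiset K j ω).sum ∂μ) *
        ∫ ω, z ^ (depthMultiset K (n - j) ω).sum ∂μ := by
  have hP : ∀ m, attachmentSum z m {0} =
      (m.factorial : ℂ) * ∫ ω, z ^ (depthMultiset K m ω).sum ∂μ := fun m => by
    have := hK.integral_attachmentSum z 0 m
    rw [zero_add] at this
    exact this.symm
  have hrec := attachmentSum_succ_singleton z n
  simp only [hP] at hrec
  have hn : (n : ℂ) + 1 ≠ 0 := by exact_mod_cast n.succ_ne_zero
  have hf : (n.factorial : ℂ) ≠ 0 := by exact_mod_cast n.factorial_ne_zero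
  rw [Nat.factorial_succ] at hrec
  rw [eq_inv_mul_iff_mul_eq₀ hn]
  refine mul_left_cancel₀ hf ?_
  calc _ = ((((n + 1) * n.factorial : ℕ)) : ℂ) * _ := by push_cast; ring
    _ = _ := hrec
    _ = _ := by
      rw [Finset.Nat.sum_antidiagonal_eq_sum_range_succ_mk, Finset.mul_sum]
      refine Finset.sum_congr rfl fun j hj => ?_
      have hj' : j ≤ n := Nat.lt_succ_iff.1 (Finset.mem_range.1 hj)
      have hc : (n.choose j : ℂ) * j.factorial * (n - j).factorial = n.factorial := by
        exact_mod_cast Nat.choose_mul_factorial_mul_factorial hj'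
      rw [← hc]
      ring

end IsUniformAttachment

/-! ### The limit of the splitting recursion -/

/-- Realizes the uniform subtree size through a continuous uniform `u`, so that dominated
convergence can be used pointwise in `u`. -/
theorem inv_mul_sum_eq_integral_floor {m : ℕ} (hm : 0 < m) (F : ℕ → ℂ) :
    (m : ℂ)⁻¹ * ∑ j ∈ Finset.range m, F j = ∫ u in (0 : ℝ)..1, F ⌊u * m⌋₊ := by
  have hfloor : ∀ j : ℕ, ∀ x ∈ Set.uIoo (j : ℝ) ((j + 1 : ℕ) : ℝ), F j = F ⌊x⌋₊ := by
    intro j x hx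
    have hj : (j : ℝ) ≤ ((j + 1 : ℕ) : ℝ) := by exact_mod_cast j.le_succ
    rw [Set.uIoo_of_le hj] at hx
    rw [(Nat.floor_eq_iff (j.cast_nonneg.trans hx.1.le)).2 ⟨hx.1.le, by
      have := hx.2; push_cast at this; exact this⟩]
  have hint : ∀ j : ℕ, IntervalIntegrable (fun x : ℝ => F ⌊x⌋₊) volume (j : ℝ) ((j + 1 : ℕ) : ℝ) :=
    fun j => intervalIntegrable_const.congr_uIoo (f := fun _ => F j) fun x hx => hfloor j x hx
  have hone : ∀ j : ℕ, ∫ x in (j : ℝ)..((j + 1 : ℕ) : ℝ), F ⌊x⌋₊ = F j := by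
    intro j
    rw [← intervalIntegral.integral_congr_uIoo (f := fun _ => F j) fun x hx => hfloor j x hx]
    simp
  have hm' : (m : ℝ) ≠ 0 := by exact_mod_cast hm.ne'
  rw [intervalIntegral.integral_comp_mul_right (fun x : ℝ => F ⌊x⌋₊) hm', zero_mul, one_mul,
    ← Nat.cast_zero, ← intervalIntegral.sum_integral_adjacent_intervals (a := fun j : ℕ => (j : ℝ))
      fun j _ => hint j]
  simp only [hone]
  rw [Complex.real_smul]
  push_cast
  rfl

/-- The characteristic function of the normalized path length. -/
noncomputable def normalizedCharFun {Ω : Type*} [MeasurableSpace Ω] (μ : Measure Ω)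
    (K : ∀ i : ℕ, Ω → Fin (i + 1)) (n : ℕ) (t : ℝ) : ℂ :=
  ∫ ω, Complex.exp (Complex.I * ↑(t * normalizedPathLength μ K n ω)) ∂μ

/-- The cost of splitting off a subtree with `j + 1` of the `n + 2` vertices. -/
noncomputable def splittingToll (n j : ℕ) : ℝ :=
  (j + 1 + (j + 1) * ((harmonic (j + 1) : ℝ) - 1)
    + ((n - j : ℕ) + 1) * ((harmonic (n - j + 1) : ℝ) - 1)
    - (n + 2) * ((harmonic (n + 2) : ℝ) - 1)) / (n + 2)

/-- If the fraction of the first of two parts tends to `u`, then the toll tends to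
`u` minus the binary entropy of `u`. -/
theorem tendsto_splittingToll {u : ℝ} (hu0 : 0 < u) (hu1 : u < 1) {j : ℕ → ℕ}
    (hj : ∀ n, j n ≤ n)
    (hju : Tendsto (fun n => ((j n : ℝ) + 1) / (n + 2)) atTop (𝓝 u))
    (hj1 : Tendsto j atTop atTop) (hj2 : Tendsto (fun n => n - j n) atTop atTop) :
    Tendsto (fun n => splittingToll n (j n)) atTop (𝓝 (u - Real.binEntropy u)) := by
  have hju' : Tendsto (fun n => (((n - j n : ℕ) : ℝ) + 1) / (n + 2)) atTop (𝓝 (1 - u)) := by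
    refine (hju.const_sub 1).congr fun n => ?_
    have : (n : ℝ) + 2 ≠ 0 := by positivity
    rw [Nat.cast_sub (hj n)]
    field_simp
    ring
  have hharm : ∀ i : ℕ → ℕ, Tendsto i atTop atTop → Tendsto
      (fun n => (harmonic (i n) : ℝ) - Real.log (i n)) atTop (𝓝 Real.eulerMascheroniConstant) :=
    fun i hi => Real.tendsto_harmonic_sub_log.comp hi
  have h2 := hharm (fun n => n + 2) (tendsto_add_atTop_nat 2)
  -- Euler's constant cancels in the difference of harmonic numbers, leaving the logarithm of the
  -- ratio.
  have hdiff : ∀ (i : ℕ → ℕ) (v : ℝ), 0 < v → Tendsto i atTop atTop →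
      Tendsto (fun n => ((i n : ℝ) + 1) / (n + 2)) atTop (𝓝 v) →
      Tendsto (fun n => ((i n : ℝ) + 1) / (n + 2) *
        ((harmonic (i n + 1) : ℝ) - harmonic (n + 2))) atTop (𝓝 (v * Real.log v)) := by
    intro i v hv hi hlim
    have h1 := hharm (fun n => i n + 1) (tendsto_add_atTop_nat 1 |>.comp hi)
    have h3 := (h1.sub h2).add (hlim.log hv.ne')
    rw [sub_self, zero_add] at h3
    refine (hlim.mul h3).congr fun n => ?_
    rw [Real.log_div (by positivity) (by positivity)]
    push_cast
    ring
  have hA := hdiff j u hu0 hj1 hju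
  have hB := hdiff (fun n => n - j n) (1 - u) (by linarith) hj2 hju'
  have hlim : u - Real.binEntropy u = u + u * Real.log u + (1 - u) * Real.log (1 - u) := by
    rw [Real.binEntropy_eq_negMulLog_add_negMulLog_one_sub, Real.negMulLog, Real.negMulLog]
    ring
  rw [hlim]
  refine ((hju.add hA).add hB).congr fun n => ?_
  have : (n : ℝ) + 2 ≠ 0 := by positivity
  rw [splittingToll, Nat.cast_sub (hj n)]
  field_simp
  ring

namespace IsUniformAttachment

variable {Ω : Type*} [MeasurableSpace Ω] {μ : Measure Ω}
  {K : ∀ i : ℕ, Ω → Fin (i + 1)}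

theorem integral_exp_pow_sum_depthMultiset (n : ℕ) (s : ℝ) :
    ∫ ω, Complex.exp (Complex.I * s) ^ (depthMultiset K n ω).sum ∂μ =
      Complex.exp (Complex.I * ↑(s * ∫ ω, rrtPathLength K n ω ∂μ)) *
        normalizedCharFun μ K n (s * (n + 1)) := by
  rw [normalizedCharFun, ← integral_const_mul]
  refine integral_congr_ae (Eventually.of_forall fun ω => ?_)
  simp only
  rw [← Complex.exp_nat_mul, ← Complex.exp_add]
  congr 1
  have : ((depthMultiset K n ω).sum : ℂ) = ((rrtPathLength K n ω : ℝ) : ℂ) := by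
    rw [← sum_depthMultiset, Complex.ofReal_natCast]
  rw [this, normalizedPathLength]
  have hn : (n : ℂ) + 1 ≠ 0 := by exact_mod_cast n.succ_ne_zero
  push_cast
  field_simp
  ring

variable [IsProbabilityMeasure μ]

theorem norm_normalizedCharFun_le (n : ℕ) (t : ℝ) : ‖normalizedCharFun μ K n t‖ ≤ 1 := by
  have := norm_integral_le_of_norm_le_const (μ := μ)
    (f := fun ω => Complex.exp (Complex.I * ↑(t * normalizedPathLength μ K n ω))) (C := 1)
    (Eventually.of_forall fun ω => (norm_exp_I_mul_ofReal _).le)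
  simpa [normalizedCharFun] using this

theorem normalizedCharFun_succ (hK : IsUniformAttachment μ K) (n : ℕ) (t : ℝ) :
    normalizedCharFun μ K (n + 1) t = ((n + 1 : ℕ) : ℂ)⁻¹ * ∑ j ∈ Finset.range (n + 1),
      Complex.exp (Complex.I * ↑(t * splittingToll n j)) *
        (normalizedCharFun μ K j (t * (((j : ℝ) + 1) / (n + 2))) *
          normalizedCharFun μ K (n - j) (t * ((((n - j : ℕ) : ℝ) + 1) / (n + 2)))) := by
  -- The tree with index `n + 1` has `n + 2` vertices, which is the normalization hidden in this
  -- `z`.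
  have hrec := hK.integral_pow_sum_depthMultiset_succ
    (Complex.exp (Complex.I * ((t / (n + 2) : ℝ) : ℂ))) n
  have hn : (n : ℝ) + 2 ≠ 0 := by positivity
  have ht : t / (n + 2) * (((n + 1 : ℕ) : ℝ) + 1) = t := by
    push_cast
    field_simp
    ring
  simp only [integral_exp_pow_sum_depthMultiset, ht] at hrec
  have hne := Complex.exp_ne_zero
    (Complex.I * ↑(t / ((n : ℝ) + 2) * ∫ ω, rrtPathLength K (n + 1) ω ∂μ))
  refine mul_left_cancel₀ hne ?_
  rw [hrec, mul_left_comm, Finset.mul_sum _ _ (Complex.exp _), Nat.cast_succ]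
  congr 1
  refine Finset.sum_congr rfl fun j hj => ?_
  have hexp : Complex.exp (Complex.I * ↑(t / ((n : ℝ) + 2) * ∫ ω, rrtPathLength K (n + 1) ω ∂μ)) *
      Complex.exp (Complex.I * ↑(t * splittingToll n j)) =
      Complex.exp (Complex.I * ↑(t / ((n : ℝ) + 2))) ^ (j + 1) *
        Complex.exp (Complex.I * ↑(t / ((n : ℝ) + 2) * ∫ ω, rrtPathLength K j ω ∂μ)) *
        Complex.exp (Complex.I * ↑(t / ((n : ℝ) + 2) * ∫ ω, rrtPathLength K (n - j) ω ∂μ)) := by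
    rw [← Complex.exp_nat_mul, ← Complex.exp_add, ← Complex.exp_add, ← Complex.exp_add]
    congr 1
    rw [mul_left_comm, ← mul_add, ← mul_add, ← mul_add, hK.integral_rrtPathLength,
      hK.integral_rrtPathLength, hK.integral_rrtPathLength, splittingToll]
    congr 1
    have hn' : (n : ℂ) + 2 ≠ 0 := by exact_mod_cast (by omega : n + 2 ≠ 0)
    push_cast
    field_simp
    ring
  have harg : ∀ x : ℝ, t / (n + 2) * x = t * (x / (n + 2)) := fun x => by ring
  rw [harg ((j : ℝ) + 1), harg (((n - j : ℕ) : ℝ) + 1)]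
  push_cast at hexp ⊢
  linear_combination -(normalizedCharFun μ K j (t * (((j : ℝ) + 1) / (n + 2))) *
    normalizedCharFun μ K (n - j) (t * ((((n - j : ℕ) : ℝ) + 1) / (n + 2)))) * hexp

/-- Index and argument vary together because the sizes of the parts and their fractions do. -/
theorem tendsto_normalizedCharFun (hK : IsUniformAttachment μ K) {X : Ω → ℝ}
    (hX : AEMeasurable X μ)
    (hlim : ∀ᵐ ω ∂μ, Tendsto (fun n => normalizedPathLength μ K n ω) atTop (𝓝 (X ω)))
    {k : ℕ → ℕ} (hk : Tendsto k atTop atTop) {s : ℕ → ℝ} {t : ℝ} (hs : Tendsto s atTop (𝓝 t)) :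
    Tendsto (fun n => normalizedCharFun μ K (k n) (s n)) atTop (𝓝 (charFun (μ.map X) t)) := by
  rw [charFun_apply_real, integral_map hX (by fun_prop)]
  refine tendsto_integral_of_dominated_convergence (fun _ => 1) (fun n => ?_)
    (integrable_const _) (fun n => Eventually.of_forall fun ω => (norm_exp_I_mul_ofReal _).le) ?_
  · have hm := ((historyDetermined_normalizedPathLength (μ := μ) (K := K) (k n)).comp fun x =>
      Complex.exp (Complex.I * ↑(s n * x))).stronglyMeasurable
    exact (hm.mono (hK.filtration.le _)).aestronglyMeasurable
  · filter_upwards [hlim] with ω hω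
    have h1 : Tendsto (fun n => s n * normalizedPathLength μ K (k n) ω) atTop (𝓝 (t * X ω)) :=
      hs.mul (hω.comp hk)
    have hc : Continuous fun x : ℝ => Complex.exp (Complex.I * (x : ℂ)) := by fun_prop
    have := (hc.tendsto _).comp h1
    simpa only [Function.comp_def, Complex.ofReal_mul, mul_comm Complex.I] using this

theorem solvesSplittingEquation (hK : IsUniformAttachment μ K) {X : Ω → ℝ}
    (hX : AEMeasurable X μ)
    (hlim : ∀ᵐ ω ∂μ, Tendsto (fun n => normalizedPathLength μ K n ω) atTop (𝓝 (X ω))) :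
    SolvesSplittingEquation (μ.map X) := by
  intro t
  let Φ : ℕ → ℕ → ℂ := fun n j => Complex.exp (Complex.I * ↑(t * splittingToll n j)) *
        (normalizedCharFun μ K j (t * (((j : ℝ) + 1) / (n + 2))) *
          normalizedCharFun μ K (n - j) (t * ((((n - j : ℕ) : ℝ) + 1) / (n + 2))))
  have hrec : ∀ n : ℕ, normalizedCharFun μ K (n + 1) t =
      ∫ u in (0 : ℝ)..1, Φ n ⌊u * (n + 1 : ℕ)⌋₊ := fun n => by
    rw [← inv_mul_sum_eq_integral_floor n.succ_pos (Φ n)]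
    exact hK.normalizedCharFun_succ n t
  have hleft : Tendsto (fun n => normalizedCharFun μ K (n + 1) t) atTop
      (𝓝 (charFun (μ.map X) t)) :=
    hK.tendsto_normalizedCharFun hX hlim (tendsto_add_atTop_nat 1) tendsto_const_nhds
  refine tendsto_nhds_unique hleft ?_
  simp only [hrec]
  refine intervalIntegral.tendsto_integral_filter_of_dominated_convergence (fun _ => 1)
    (Eventually.of_forall fun n => ?_) (Eventually.of_forall fun n => ?_)
    intervalIntegrable_const ?_
  · have : Measurable fun u : ℝ => ⌊u * (n + 1 : ℕ)⌋₊ :=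
      Nat.measurable_floor.comp (measurable_id.mul_const _)
    exact ((measurable_from_nat (f := Φ n)).comp this).aestronglyMeasurable
  · refine Eventually.of_forall fun u _ => ?_
    simp only [Φ]
    rw [norm_mul, norm_exp_I_mul_ofReal, one_mul, norm_mul]
    exact mul_le_one₀ (norm_normalizedCharFun_le _ _) (norm_nonneg _)
      (norm_normalizedCharFun_le _ _)
  -- At `u = 1` the index would be `n + 1`, outside the range of the split. For `0 < u < 1` both
  -- parts grow, with fractions tending to `u` and `1 - u`.
  · have hne : ∀ᵐ u : ℝ, u ≠ 1 := by simp [ae_iff]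
    filter_upwards [hne] with u hu1 hu
    rw [Set.uIoc_of_le zero_le_one] at hu
    have hu0 := hu.1
    have hu1 : u < 1 := lt_of_le_of_ne hu.2 hu1
    set j : ℕ → ℕ := fun n => ⌊u * (n + 1 : ℕ)⌋₊ with hj
    have hjn : ∀ n, j n ≤ n := fun n => by
      refine Nat.lt_succ_iff.1 ((Nat.floor_lt (by positivity)).2 ?_)
      have : (0 : ℝ) < ((n + 1 : ℕ) : ℝ) := by positivity
      calc u * ((n + 1 : ℕ) : ℝ) < 1 * ((n + 1 : ℕ) : ℝ) := by gcongr
        _ = _ := by rw [one_mul]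
    have hlin : Tendsto (fun n : ℕ => u * ((n + 1 : ℕ) : ℝ)) atTop atTop :=
      (tendsto_natCast_atTop_atTop.comp (tendsto_add_atTop_nat 1)).const_mul_atTop hu0
    have hj1 : Tendsto j atTop atTop := tendsto_nat_floor_atTop.comp hlin
    have hj2 : Tendsto (fun n => n - j n) atTop atTop := by
      rw [← tendsto_natCast_atTop_iff (R := ℝ)]
      have hlin2 : Tendsto (fun n : ℕ => (1 - u) * (n : ℝ) - u) atTop atTop :=
        tendsto_atTop_add_const_right _ _
          (tendsto_natCast_atTop_atTop.const_mul_atTop (by linarith))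
      refine tendsto_atTop_mono (fun n => ?_) hlin2
      rw [Nat.cast_sub (hjn n)]
      have := Nat.floor_le (by positivity : 0 ≤ u * ((n + 1 : ℕ) : ℝ))
      push_cast at this
      simp only [hj]
      push_cast
      linarith
    have hinv : Tendsto (fun n : ℕ => ((n : ℝ) + 2)⁻¹) atTop (𝓝 0) :=
      tendsto_inv_atTop_zero.comp (tendsto_atTop_add_const_right _ _ tendsto_natCast_atTop_atTop)
    have hju : Tendsto (fun n => ((j n : ℝ) + 1) / (n + 2)) atTop (𝓝 u) := by
      refine tendsto_of_tendsto_of_tendsto_of_le_of_le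
        (g := fun n : ℕ => u - u * ((n : ℝ) + 2)⁻¹) (h := fun n : ℕ => u + 1 * ((n : ℝ) + 2)⁻¹)
        (by simpa using (hinv.const_mul u).const_sub u)
        (by simpa using (hinv.const_mul 1).const_add u) (fun n => ?_) (fun n => ?_)
      · have hn : (0 : ℝ) < (n : ℝ) + 2 := by positivity
        have := Nat.lt_floor_add_one (u * ((n + 1 : ℕ) : ℝ))
        simp only [hj]
        rw [le_div_iff₀ hn, sub_mul, mul_assoc, inv_mul_cancel₀ hn.ne']
        push_cast at this ⊢
        linarith
      · have hn : (0 : ℝ) < (n : ℝ) + 2 := by positivity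
        have := Nat.floor_le (by positivity : 0 ≤ u * ((n + 1 : ℕ) : ℝ))
        simp only [hj]
        rw [div_le_iff₀ hn, add_mul, mul_assoc, inv_mul_cancel₀ hn.ne']
        push_cast at this ⊢
        linarith
    have hju' : Tendsto (fun n => (((n - j n : ℕ) : ℝ) + 1) / (n + 2)) atTop (𝓝 (1 - u)) := by
      refine (hju.const_sub 1).congr fun n => ?_
      have : (n : ℝ) + 2 ≠ 0 := by positivity
      rw [Nat.cast_sub (hjn n)]
      field_simp
      ring
    have h1 := hK.tendsto_normalizedCharFun hX hlim hj1 (hju.const_mul t)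
    have h2 := hK.tendsto_normalizedCharFun hX hlim hj2 (hju'.const_mul t)
    have h3 := (tendsto_splittingToll hu0 hu1 hjn hju hj1 hj2).const_mul t
    have hc : Continuous fun x : ℝ => Complex.exp (Complex.I * (x : ℂ)) := by fun_prop
    have h4 := ((hc.tendsto _).comp h3).mul (h1.mul h2)
    rw [mul_comm u t, mul_comm (1 - u) t, mul_comm (_ * _) (Complex.exp _)]
    exact h4

end IsUniformAttachment

theorem mainTheorem12 {Ω : Type*} [MeasurableSpace Ω] (μ : Measure Ω) [IsProbabilityMeasure μ]
    (K : ∀ i : ℕ, Ω → Fin (i + 1)) (hK : IsUniformAttachment μ K) :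
    (∃ X : Ω → ℝ, Measurable X ∧
      (∀ᵐ ω ∂μ, Tendsto (fun n => normalizedPathLength μ K n ω) atTop (𝓝 (X ω))) ∧
      ∀ p : ℝ≥0∞, 0 < p → p ≠ ∞ → MemLp X p μ ∧
        Tendsto (fun n => eLpNorm (fun ω => normalizedPathLength μ K n ω - X ω) p μ)
          atTop (𝓝 0)) ∧
    ∀ X : Ω → ℝ, AEMeasurable X μ →
      (∀ᵐ ω ∂μ, Tendsto (fun n => normalizedPathLength μ K n ω) atTop (𝓝 (X ω))) →
      HasSchwartzDensity (μ.map X) := by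
  refine ⟨hK.exists_limit, fun X hX hlim => ?_⟩
  have := Measure.isProbabilityMeasure_map hX
  obtain ⟨Y, -, hY, hLp⟩ := hK.exists_limit
  -- Almost sure limits agree, so `X` inherits the moments of `Y`.
  have hXY : Y =ᵐ[μ] X := by
    filter_upwards [hlim, hY] with ω h1 h2
    exact tendsto_nhds_unique h2 h1
  refine (hK.solvesSplittingEquation hX hlim).hasSchwartzDensity fun k => ?_
  rw [memLp_map_measure_iff (by fun_prop) hX, Function.id_comp]
  rcases Nat.eq_zero_or_pos k with rfl | hk
  -- The exponent `0` is not covered by `hLp`; there `MemLp` only asks for measurability.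
  · exact_mod_cast memLp_zero_iff_aestronglyMeasurable.2 hX.aestronglyMeasurable
  · exact (hLp k (by exact_mod_cast hk) (ENNReal.natCast_ne_top k)).1.ae_eq hXY
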